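/- For an integer $n\ge 0$ let $B_n$ be the Artin braid group on $n$ strings, with generators $\sigma_1,\dots,\sigma_{n-1}$ and relations $\sigma_i\sigma_j=\sigma_j\sigma_i$ for $|i-j|\ge 2$ and $\sigma_{i+1}\sigma_i\sigma_{i+1}=\sigma_i\sigma_{i+1}\sigma_i$. Let $P_n$ be the pure braid group, that is, the kernel of the homomorphism $B_n\to S_n$ with $\sigma_i\mapsto(i,\,i+1)$. A Bieberbach group of dimension $d$ is a torsion-free group isomorphic to a discrete and uniform (cocompact) subgroup of $\mathbb R^d\rtimes O(d,\mathbb R)$. It has holonomy group $\Phi$ if there is a short exact sequence $0\to\mathbb Z^d\to\Pi\to\Phi\to 1$ with $\Phi$ finite such that the action of $\Phi$ on $\mathbb Z^d$ induced by conjugation in $\Pi$ is faithful. **Proposition.** Let $H=\mathbb Z_{n_1}\times\cdots\times\mathbb Z_{n_t}$ $(t\ge 0)$, where each $n_i\geq 3$ is a power of a prime (the primes need not be distinct), and let $m$ be an integer with $\sum_{i=1}^t n_i\le m$. Then $\sum_{i=1}^t\binom{n_i}{2}\le\binom m2$, and the group $B_m/[P_m,P_m]$ has a Bieberbach subgroup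 $\Gamma$ of dimension $\sum_{i=1}^t\binom{n_i}{2}$ with holonomy group $H$. Moreover, $\Gamma$ can be taken of the form $\Gamma=\overline\iota(\Gamma_1\times\cdots\times\Gamma_t)$, where $\Gamma_i$ is a Bieberbach subgroup of $B_{n_i}/[P_{n_i},P_{n_i}]$ of dimension $\binom{n_i}{2}$ with holonomy group $\mathbb Z_{n_i}$, and $$\overline\iota\colon \frac{B_{n_1}}{[P_{n_1},P_{n_1}]}\times\cdots\times\frac{B_{n_t}}{[P_{n_t},P_{n_t}]}\to\frac{B_m}{[P_m,P_m]}$$ is an injective homomorphism sending the class of $\sigma_j$ in the $i$-th factor to the class of $\sigma_{n_1+\cdots+n_{i-1}+j}$, for $1\le i\le t$ and $1\le j\le n_i-1$. -/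

import Mathlib

/-! ### Artin braid groups -/

/-- The defining relators of the Artin braid group on `n` strings. The generator `σ_{i+1}` of the
usual presentation has the index `i : Fin (n - 1)`. -/
def braidRelators (n : ℕ) : Set (FreeGroup (Fin (n - 1))) :=
  {r | ∃ i j : Fin (n - 1), (i : ℕ) + 2 ≤ (j : ℕ) ∧
      r = (FreeGroup.of i * FreeGroup.of j) * (FreeGroup.of j * FreeGroup.of i)⁻¹} ∪
  {r | ∃ i j : Fin (n - 1), (j : ℕ) = (i : ℕ) + 1 ∧
      r = (FreeGroup.of j * FreeGroup.of i * FreeGroup.of j) *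
        (FreeGroup.of i * FreeGroup.of j * FreeGroup.of i)⁻¹}

/-- The Artin braid group `B_n` on `n` strings (trivial for `n = 0` and `n = 1`). -/
abbrev BraidGroup (n : ℕ) : Type := PresentedGroup (braidRelators n)

/-- The transposition `(i, i + 1)` of the `n` positions. -/
def adjTransposition (n : ℕ) (i : Fin (n - 1)) : Equiv.Perm (Fin n) :=
  Equiv.swap ⟨i, by omega⟩ ⟨(i : ℕ) + 1, by omega⟩

theorem adjTransposition_relators (n : ℕ) :
    ∀ r ∈ braidRelators n, FreeGroup.lift (adjTransposition n) r = 1 := by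
  rintro r (⟨i, j, hij, rfl⟩ | ⟨i, j, hij, rfl⟩)
  · rw [map_mul, map_inv, mul_inv_eq_one]
    simp only [map_mul, FreeGroup.lift_apply_of]
    refine (Equiv.Perm.disjoint_swap_swap ?_).commute.eq
    simp [Fin.ext_iff]
    omega
  · rw [map_mul, map_inv, mul_inv_eq_one]
    simp only [map_mul, FreeGroup.lift_apply_of, adjTransposition, hij]
    have key : ∀ a b c : Fin n, a ≠ b → a ≠ c → b ≠ c →
        Equiv.swap b c * Equiv.swap a b * Equiv.swap b c =
          Equiv.swap a b * Equiv.swap b c * Equiv.swap a b := by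
      intro a b c hab hac hbc
      rw [Equiv.swap_mul_swap_mul_swap hab hac, Equiv.swap_comm a b, Equiv.swap_comm b c,
        Equiv.swap_mul_swap_mul_swap hbc.symm hac.symm, Equiv.swap_comm]
    apply key <;> simp only [ne_eq, Fin.mk.injEq] <;> omega

/-- The homomorphism `σ : B_n → S_n` that sends each generator to the corresponding adjacent
transposition. (Reading products of permutations in the other order replaces the value of `σ` by
its inverse and leaves the kernel the same.) -/
def braidPerm (n : ℕ) : BraidGroup n →* Equiv.Perm (Fin n) :=
  PresentedGroup.toGroup (adjTransposition_relators n)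

/-- The pure braid group `P_n`, the kernel of `σ : B_n → S_n`. -/
def pureBraidGroup (n : ℕ) : Subgroup (BraidGroup n) := (braidPerm n).ker

instance pureBraidGroup_normal (n : ℕ) : (pureBraidGroup n).Normal :=
  (braidPerm n).normal_ker

/-- The quotient group `B_n / [P_n, P_n]`. -/
abbrev BraidQuotient (n : ℕ) : Type :=
  BraidGroup n ⧸ ⁅pureBraidGroup n, pureBraidGroup n⁆

/-- The image in `B_n / [P_n, P_n]` of the Artin generator with index `i`. -/
def braidQuotientGen (n : ℕ) (i : Fin (n - 1)) : BraidQuotient n :=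
  QuotientGroup.mk (PresentedGroup.of i : BraidGroup n)

/-! ### Crystallographic and Bieberbach groups -/

/-- The action of `O(n, ℝ)` on the additive group `ℝⁿ` by matrix multiplication. -/
def orthogonalAction (n : ℕ) :
    Matrix.orthogonalGroup (Fin n) ℝ →* MulAut (Multiplicative (Fin n → ℝ)) where
  toFun A := AddEquiv.toMultiplicative
    (Matrix.UnitaryGroup.toLinearEquiv A).toAddEquiv
  map_one' := by
    ext v
    simp [Matrix.UnitaryGroup.toLinearEquiv, Matrix.UnitaryGroup.toLin']
  map_mul' A B := by
    ext v
    simp [Matrix.UnitaryGroup.toLinearEquiv, Matrix.UnitaryGroup.toLin']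

/-- The group `ℝⁿ ⋊ O(n, ℝ)` of rigid motions of Euclidean `n`-space. The pair `(v, A)` is the
motion `x ↦ v + A x`. -/
abbrev EuclideanMotion (n : ℕ) : Type :=
  Multiplicative (Fin n → ℝ) ⋊[orthogonalAction n] Matrix.orthogonalGroup (Fin n) ℝ

/-- The standard topology of `ℝⁿ ⋊ O(n, ℝ)`: that of the product `ℝⁿ × O(n, ℝ)`. -/
instance EuclideanMotion.topologicalSpace (n : ℕ) : TopologicalSpace (EuclideanMotion n) :=
  TopologicalSpace.induced
    (fun g => (Multiplicative.toAdd g.left, g.right) :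
      EuclideanMotion n → (Fin n → ℝ) × Matrix.orthogonalGroup (Fin n) ℝ) inferInstance

/-- The group `Γ` is (isomorphic to) a crystallographic group of dimension `n`, that is, to a
discrete and uniform (i.e. cocompact) subgroup of `ℝⁿ ⋊ O(n, ℝ)`. -/
def IsCrystallographic (n : ℕ) (Γ : Type*) [Group Γ] : Prop :=
  ∃ C : Subgroup (EuclideanMotion n),
    DiscreteTopology C ∧ CompactSpace (EuclideanMotion n ⧸ C) ∧ Nonempty (Γ ≃* C)

/-- There is a short exact sequence `0 → ℤⁿ → Γ → Φ → 1` with `Φ` finite, for which the integral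
representation `Θ : Φ → Aut(ℤⁿ)` induced by conjugation in `Γ` is faithful. For a
crystallographic group `Γ` this says that `Γ` has dimension `n` and holonomy group `Φ`. -/
def HasHolonomyGroup (n : ℕ) (Φ Γ : Type*) [Group Φ] [Group Γ] : Prop :=
  Finite Φ ∧
  ∃ (S : GroupExtension (Multiplicative (Fin n → ℤ)) Γ Φ)
    (Θ : Φ →* MulAut (Multiplicative (Fin n → ℤ))),
    (∀ (γ : Γ) (x : Multiplicative (Fin n → ℤ)),
      S.inl (Θ (S.rightHom γ) x) = γ * S.inl x * γ⁻¹) ∧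
    Function.Injective Θ

/-- `Γ` is a Bieberbach group (a torsion-free crystallographic group) of dimension `n` with
holonomy group (isomorphic to) `Φ`. -/
structure IsBieberbach (n : ℕ) (Φ Γ : Type*) [Group Φ] [Group Γ] : Prop where
  crystallographic : IsCrystallographic n Γ
  torsionFree : ∀ γ : Γ, IsOfFinOrder γ → γ = 1
  holonomy : HasHolonomyGroup n Φ Γ

/-! The quotient $B_n/[P_n,P_n]$ embeds in $\mathbb Z^{\text{pairs}}\rtimes S_n$ by
$\sigma_i\mapsto(e_{\{i,i+1\}},(i\ i{+}1))$, so an element is known by its permutation and by one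
integer for each unordered pair of strands. Injectivity is `quotientLinking_injective`. By the
Coxeter presentation of $S_n$ (`eq_one_of_mem_initialClosure`), $P_n/[P_n,P_n]$ is the normal
closure of the square of one generator. A conjugate of that square depends only on the pair of
strands to which it is carried (`conj_lastTwist`). So this abelian group is generated by $\binom n2$
twists, and their images $2e_s$ are independent.

For one cyclic factor, `cyclicSubgroup n` consists of the elements over $c^j$, with $c$ an
$n$-cycle, whose exponent sum is $-j$ modulo $n$; it contains $\sigma_1\cdots\sigma_{n-1}$. An
element of finite order has exponent sum $0$. Since $c$ and $-1\in\mathbb Z_n$ both have order $n$,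
such an element is pure, hence lies in a free abelian group and is trivial. All translations by
multiples of $2n$ belong to the group, and $S_n$ acts faithfully on pairs for $n\ge3$, which gives
dimension $\binom n2$ and holonomy $\mathbb Z_n$.

`LatticeData` isolates what this uses and is stable under finite products.
`LatticeData.isBieberbach` converts it into a Bieberbach group: integral entries give discreteness,
the translations give cocompactness, and the permutation of coordinates gives faithful holonomy.
Finally, placing braids side by side is injective (`juxtapose_injective`), because the invariants of
each factor can be read off on its block of strands. -/

/-! ### The Coxeter presentation of the symmetric group -/

section Coxeter

variable {K : Type*} [Group K]

/-- The product `t (l + d - 1) * ⋯ * t (l + 1) * t l`. -/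
def descProd (t : ℕ → K) (l : ℕ) : ℕ → K
  | 0 => 1
  | d + 1 => t (l + d) * descProd t l d

/-- The subgroup generated by the first `j` members of a sequence. -/
def initialClosure (t : ℕ → K) (j : ℕ) : Subgroup K :=
  Subgroup.closure (t '' Set.Iio j)

theorem mem_initialClosure (t : ℕ → K) {i j : ℕ} (h : i < j) : t i ∈ initialClosure t j :=
  Subgroup.subset_closure ⟨i, h, rfl⟩

theorem descProd_succ_right (t : ℕ → K) (l d : ℕ) :
    descProd t (l + 1) d * t l = descProd t l (d + 1) := by
  induction d with
  | zero => simp [descProd]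
  | succ d ih =>
    rw [descProd, mul_assoc, ih, show l + 1 + d = l + (d + 1) by ring]
    rfl

/-- The braid relations for the first `k` members of a sequence. -/
structure BraidRelations (t : ℕ → K) (k : ℕ) : Prop where
  comm : ∀ i j, i + 2 ≤ j → j < k → t i * t j = t j * t i
  braid : ∀ i, i + 1 < k → t (i + 1) * t i * t (i + 1) = t i * t (i + 1) * t i

variable {t : ℕ → K} {k : ℕ}

theorem BraidRelations.map {K' : Type*} [Group K'] (h : BraidRelations t k) (f : K →* K') :
    BraidRelations (fun i => f (t i)) k where
  comm i j hij hj := by rw [← map_mul, h.comm i j hij hj, map_mul]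
  braid i hi := by simp only [← map_mul, h.braid i hi]

theorem descProd_comm_below (h : BraidRelations t k) {l d i : ℕ} (hd : l + d ≤ k)
    (hi : i + 2 ≤ l) : descProd t l d * t i = t i * descProd t l d := by
  induction d with
  | zero => simp [descProd]
  | succ d ih =>
    rw [descProd, mul_assoc, ih (by omega), ← mul_assoc, ← h.comm i (l + d) (by omega) (by omega),
      mul_assoc]

theorem descProd_comm_above (h : BraidRelations t k) {l d i : ℕ} (hd : l + d + 1 ≤ i)
    (hi : i < k) : descProd t l d * t i = t i * descProd t l d := by
  induction d with
  | zero => simp [descProd]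
  | succ d ih =>
    rw [descProd, mul_assoc, ih (by omega), ← mul_assoc, h.comm (l + d) i (by omega) (by omega),
      mul_assoc]

/-- The lower factors commute with `t (i + 1)`, one braid relation turns it into `t i`, and the
remaining upper factors commute with `t i`. -/
theorem descProd_mul_mid (h : BraidRelations t k) {l d i : ℕ} (hd : l + d ≤ k)
    (hl : l ≤ i) (hi : i + 1 < l + d) :
    descProd t l d * t (i + 1) = t i * descProd t l d := by
  induction d with
  | zero => omega
  | succ d ih =>
    rcases lt_or_eq_of_le (show i + 1 ≤ l + d by omega) with h1 | h1
    · rw [descProd, mul_assoc, ih (by omega) h1, ← mul_assoc,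
        ← h.comm i (l + d) (by omega) (by omega), mul_assoc]
    · obtain ⟨e, rfl⟩ : ∃ e, d = e + 1 := ⟨d - 1, by omega⟩
      have hie : i = l + e := by omega
      subst hie
      rw [descProd, descProd, show l + (e + 1) = l + e + 1 by ring, mul_assoc, mul_assoc,
        descProd_comm_above h (by omega) (by omega), ← mul_assoc, ← mul_assoc,
        h.braid _ (by omega)]
      simp only [mul_assoc]

/-- The descending products represent the right cosets of the subgroup on one generator fewer. Right
multiplication by `t i` permits four cases: for `i + 1 < l` it moves into `y`; for `i + 1 = l` it
lengthens the product; for `i = l` it shortens it; for `i > l` it moves into `y` with its index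
lowered by one. -/
theorem exists_descProd_of_mem (h : BraidRelations t k) (hsq : ∀ i < k, t i * t i = 1) {j : ℕ}
    (hj : j < k) {x : K} (hx : x ∈ initialClosure t (j + 1)) :
    ∃ y ∈ initialClosure t j, ∃ l d, l + d = j + 1 ∧ x = y * descProd t l d := by
  have step : ∀ x, (∃ y ∈ initialClosure t j, ∃ l d, l + d = j + 1 ∧ x = y * descProd t l d) →
      ∀ i < j + 1,
        ∃ y ∈ initialClosure t j, ∃ l d, l + d = j + 1 ∧ x * t i = y * descProd t l d := by
    rintro x ⟨y, hy, l, d, hld, rfl⟩ i hi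
    rcases lt_or_ge (i + 1) l with h1 | h1
    · exact ⟨y * t i, mul_mem hy (mem_initialClosure t (by omega)), l, d, hld, by
        rw [mul_assoc, descProd_comm_below h (by omega) (by omega), mul_assoc]⟩
    rcases eq_or_lt_of_le h1 with h2 | h2
    · subst h2
      exact ⟨y, hy, i, d + 1, by omega, by rw [mul_assoc, descProd_succ_right]⟩
    rcases eq_or_lt_of_le (show l ≤ i by omega) with h3 | h3
    · subst h3
      obtain ⟨e, rfl⟩ : ∃ e, d = e + 1 := ⟨d - 1, by omega⟩
      exact ⟨y, hy, l + 1, e, by omega, by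
        rw [← descProd_succ_right, mul_assoc, mul_assoc, hsq l (by omega), mul_one]⟩
    · obtain ⟨i, rfl⟩ : ∃ e, i = e + 1 := ⟨i - 1, by omega⟩
      exact ⟨y * t i, mul_mem hy (mem_initialClosure t (by omega)), l, d, hld, by
        rw [mul_assoc, descProd_mul_mid h (by omega) (by omega) (by omega), mul_assoc]⟩
  induction hx using Subgroup.closure_induction_right with
  | one => exact ⟨1, one_mem _, j + 1, 0, rfl, by simp [descProd]⟩
  | mul_right x _ y hy ih =>
    obtain ⟨i, hi, rfl⟩ := hy
    exact step x ih i hi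
  | mul_inv_cancel x _ y hy ih =>
    obtain ⟨i, hi, rfl⟩ := hy
    rw [inv_eq_of_mul_eq_one_left (hsq i (by simp at hi; omega))]
    exact step x ih i hi

/-- The adjacent transpositions of `Fin n`, as a sequence indexed by all natural numbers. -/
def adjSwap (n i : ℕ) : Equiv.Perm (Fin n) :=
  if h : i < n - 1 then adjTransposition n ⟨i, h⟩ else 1

theorem adjSwap_of_lt {n i : ℕ} (h : i + 1 < n) :
    adjSwap n i = Equiv.swap ⟨i, by omega⟩ ⟨i + 1, h⟩ := by
  rw [adjSwap, dif_pos (by omega)]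
  rfl

theorem descProd_adjSwap {n l d : ℕ} (h : l + d < n) :
    descProd (adjSwap n) l d ⟨l, by omega⟩ = ⟨l + d, h⟩ := by
  induction d with
  | zero => simp [descProd]
  | succ d ih =>
    rw [descProd, Equiv.Perm.mul_apply, ih (by omega), adjSwap_of_lt (by omega),
      Equiv.swap_apply_left]
    rfl

theorem map_descProd {K' : Type*} [Group K'] (f : K →* K') (l d : ℕ) :
    f (descProd t l d) = descProd (fun i => f (t i)) l d := by
  induction d with
  | zero => simp [descProd]
  | succ d ih => simp [descProd, ih]

theorem descProd_congr {t' : ℕ → K} {l d : ℕ} (h : ∀ i < l + d, t i = t' i) :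
    descProd t l d = descProd t' l d := by
  induction d with
  | zero => simp [descProd]
  | succ d ih => simp only [descProd]; rw [ih fun i hi => h i (by omega), h _ (by omega)]

theorem apply_eq_of_mem_initialClosure {n : ℕ} {f : K →* Equiv.Perm (Fin n)}
    (hf : ∀ i < n - 1, f (t i) = adjSwap n i) {j : ℕ} (hj : j ≤ n - 1) {x : K}
    (hx : x ∈ initialClosure t j) (a : Fin n) (ha : j < a) : f x a = a := by
  induction hx using Subgroup.closure_induction with
  | mem x hx =>
    obtain ⟨i, hi, rfl⟩ := hx
    simp only [Set.mem_Iio] at hi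
    rw [hf i (by omega), adjSwap_of_lt (by omega)]
    apply Equiv.swap_apply_of_ne_of_ne <;> simp [Fin.ext_iff] <;> omega
  | one => simp
  | mul x y _ _ hx hy => rw [map_mul, Equiv.Perm.mul_apply, hy, hx]
  | inv x _ hx => rw [map_inv, Equiv.Perm.inv_eq_iff_eq, hx]

/-- An element of the subgroup generated by the first `j + 1` generators that fixes the last of the
points moved lies in the subgroup generated by the first `j` generators. -/
theorem mem_initialClosure_of_apply_eq {n : ℕ} (h : BraidRelations t (n - 1))
    (hsq : ∀ i < n - 1, t i * t i = 1) {f : K →* Equiv.Perm (Fin n)}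
    (hf : ∀ i < n - 1, f (t i) = adjSwap n i) {j : ℕ} (hj : j + 1 < n) {x : K}
    (hx : x ∈ initialClosure t (j + 1)) (hfix : f x ⟨j + 1, hj⟩ = ⟨j + 1, hj⟩) :
    x ∈ initialClosure t j := by
  obtain ⟨y, hy, l, d, hld, rfl⟩ := exists_descProd_of_mem h hsq (by omega) hx
  -- The coset representative carries `l` to `j + 1`, which `y` fixes. As `j + 1` is itself fixed,
  -- `l = j + 1` and the representative is trivial.
  have h1 : f (y * descProd t l d) ⟨l, by omega⟩ = ⟨j + 1, hj⟩ := by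
    rw [map_mul, Equiv.Perm.mul_apply, map_descProd,
      descProd_congr (t' := adjSwap n) (fun i hi => hf i (by omega)),
      descProd_adjSwap (by omega),
      apply_eq_of_mem_initialClosure hf (by omega) hy _ (by simp; omega)]
    simp [hld]
  have h2 := (f (y * descProd t l d)).injective (h1.trans hfix.symm)
  simp only [Fin.mk.injEq] at h2
  obtain rfl : d = 0 := by omega
  simpa [descProd] using hy

/-- A trivial permutation fixes every point, so the generators can be discarded one at a time from
the top. This is faithfulness of the Coxeter presentation, in a form applicable to any quotient of
the braid group. -/
theorem eq_one_of_mem_initialClosure {n : ℕ} (h : BraidRelations t (n - 1))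
    (hsq : ∀ i < n - 1, t i * t i = 1) {f : K →* Equiv.Perm (Fin n)}
    (hf : ∀ i < n - 1, f (t i) = adjSwap n i) {j : ℕ} (hj : j ≤ n - 1) {x : K}
    (hx : x ∈ initialClosure t j) (hfx : f x = 1) : x = 1 := by
  induction j with
  | zero => simpa [initialClosure] using hx
  | succ j ih =>
    exact ih (by omega) (mem_initialClosure_of_apply_eq h hsq hf (by omega) hx (by simp [hfx]))

end Coxeter

/-! ### Generators and universal property of the braid group -/

theorem adjSwap_mul_self (n i : ℕ) : adjSwap n i * adjSwap n i = 1 := by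
  rw [adjSwap]
  split_ifs
  · exact Equiv.swap_mul_self _ _
  · simp

/-- The Artin generators, as a sequence indexed by all natural numbers. -/
def braidSeq (n i : ℕ) : BraidGroup n :=
  if h : i < n - 1 then PresentedGroup.of ⟨i, h⟩ else 1

theorem braidPerm_braidSeq (n i : ℕ) : braidPerm n (braidSeq n i) = adjSwap n i := by
  rw [braidSeq, adjSwap]
  split_ifs
  · exact PresentedGroup.toGroup.of _
  · simp

theorem braidRelations_braidSeq (n : ℕ) : BraidRelations (braidSeq n) (n - 1) where
  comm i j hij hj := by
    rw [braidSeq, braidSeq, dif_pos hj, dif_pos (by omega)]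
    have : (FreeGroup.of (⟨i, by omega⟩ : Fin (n - 1)) * FreeGroup.of ⟨j, hj⟩) *
      (FreeGroup.of ⟨j, hj⟩ * FreeGroup.of ⟨i, by omega⟩)⁻¹ ∈ braidRelators n :=
      Or.inl ⟨⟨i, by omega⟩, ⟨j, hj⟩, hij, rfl⟩
    exact PresentedGroup.mk_eq_mk_of_mul_inv_mem this
  braid i hi := by
    rw [braidSeq, braidSeq, dif_pos hi, dif_pos (by omega)]
    have : (FreeGroup.of (⟨i + 1, hi⟩ : Fin (n - 1)) * FreeGroup.of ⟨i, by omega⟩ *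
        FreeGroup.of ⟨i + 1, hi⟩) * (FreeGroup.of ⟨i, by omega⟩ * FreeGroup.of ⟨i + 1, hi⟩ *
        FreeGroup.of ⟨i, by omega⟩)⁻¹ ∈ braidRelators n :=
      Or.inr ⟨⟨i, by omega⟩, ⟨i + 1, hi⟩, rfl, rfl⟩
    exact PresentedGroup.mk_eq_mk_of_mul_inv_mem this

theorem initialClosure_braidSeq (n : ℕ) : initialClosure (braidSeq n) (n - 1) = ⊤ := by
  rw [eq_top_iff, ← PresentedGroup.closure_range_of, initialClosure]
  apply Subgroup.closure_mono
  rintro _ ⟨i, rfl⟩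
  exact ⟨i, i.2, by rw [braidSeq, dif_pos i.2]⟩

theorem map_initialClosure {K K' : Type*} [Group K] [Group K'] (f : K →* K') (t : ℕ → K) (j : ℕ) :
    (initialClosure t j).map f = initialClosure (fun i => f (t i)) j := by
  rw [initialClosure, initialClosure, MonoidHom.map_closure, Set.image_image]

theorem initialClosure_adjSwap (n : ℕ) : initialClosure (adjSwap n) (n - 1) = ⊤ := by
  obtain _ | n := n
  · exact Subsingleton.elim _ _
  rw [eq_top_iff, ← Subgroup.toSubmonoid_le, Subgroup.top_toSubmonoid,
    ← Equiv.Perm.mclosure_swap_castSucc_succ n, Submonoid.closure_le]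
  rintro _ ⟨i, rfl⟩
  exact Subgroup.subset_closure ⟨i, i.2, by rw [adjSwap_of_lt (by omega)]; rfl⟩

theorem braidPerm_surjective (n : ℕ) : Function.Surjective (braidPerm n) := by
  rw [← MonoidHom.range_eq_top, MonoidHom.range_eq_map, ← initialClosure_braidSeq,
    map_initialClosure, ← initialClosure_adjSwap]
  congr 1
  ext1 i
  exact braidPerm_braidSeq n i

/-- The homomorphism from the braid group given by a family that satisfies the braid relations. -/
def braidLift {K : Type*} [Group K] {t : ℕ → K} {n : ℕ} (h : BraidRelations t (n - 1)) :
    BraidGroup n →* K :=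
  PresentedGroup.toGroup (f := fun i : Fin (n - 1) => t i) <| by
    rintro r (⟨i, j, hij, rfl⟩ | ⟨i, j, hij, rfl⟩)
    · rw [map_mul, map_inv, mul_inv_eq_one]
      simp only [map_mul, FreeGroup.lift_apply_of]
      exact h.comm i j hij j.2
    · rw [map_mul, map_inv, mul_inv_eq_one]
      simp only [map_mul, FreeGroup.lift_apply_of, hij]
      exact h.braid i (by omega)

theorem braidLift_braidSeq {K : Type*} [Group K] {t : ℕ → K} {n : ℕ}
    (h : BraidRelations t (n - 1)) {i : ℕ} (hi : i < n - 1) :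
    braidLift h (braidSeq n i) = t i := by
  rw [braidSeq, dif_pos hi]
  exact PresentedGroup.toGroup.of _

/-! ### The linking homomorphism -/

/-- The unordered pairs of distinct elements of `Fin n`. -/
abbrev StrandPair (n : ℕ) : Type := {s : Sym2 (Fin n) // ¬ s.IsDiag}

/-- The pair formed by two distinct elements. -/
def strandPair {n : ℕ} (a b : Fin n) (h : a ≠ b) : StrandPair n :=
  ⟨s(a, b), by simpa using h⟩

theorem exists_strandPair {n : ℕ} (s : StrandPair n) : ∃ a b h, s = strandPair a b h := by
  obtain ⟨s, hs⟩ := s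
  induction s with
  | h a b => exact ⟨a, b, by simpa using hs, rfl⟩

theorem strandPair_eq_iff {n : ℕ} {a b c d : Fin n} {h : a ≠ b} {h' : c ≠ d} :
    strandPair a b h = strandPair c d h' ↔ (a = c ∧ b = d) ∨ (a = d ∧ b = c) := by
  simp [strandPair]

instance StrandPair.mulAction (n : ℕ) : MulAction (Equiv.Perm (Fin n)) (StrandPair n) where
  smul g s := ⟨s.1.map g, by
    obtain ⟨a, b, h, rfl⟩ := exists_strandPair s
    simpa [strandPair] using h⟩
  one_smul s := by
    obtain ⟨a, b, h, rfl⟩ := exists_strandPair s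
    rfl
  mul_smul g g' s := by
    obtain ⟨a, b, h, rfl⟩ := exists_strandPair s
    rfl

theorem smul_strandPair {n : ℕ} (g : Equiv.Perm (Fin n)) (a b : Fin n) (h : a ≠ b) :
    g • strandPair a b h = strandPair (g a) (g b) (g.injective.ne h) := rfl

/-- For `n ≥ 3` the symmetric group acts faithfully on the unordered pairs. -/
theorem eq_one_of_smul_strandPair {n : ℕ} (hn : 3 ≤ n) {g : Equiv.Perm (Fin n)}
    (h : ∀ s : StrandPair n, g • s = s) : g = 1 := by
  ext a : 1
  obtain ⟨b, hb⟩ : ∃ b : Fin n, b ∉ ({a} : Finset (Fin n)) := by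
    by_contra! hc
    have := Finset.card_le_card (Finset.subset_iff.mpr fun x (_ : x ∈ Finset.univ) => hc x)
    simp at this
    omega
  obtain ⟨c, hc⟩ : ∃ c : Fin n, c ∉ ({a, b} : Finset (Fin n)) := by
    by_contra! hc
    have := Finset.card_le_card (Finset.subset_iff.mpr fun x (_ : x ∈ Finset.univ) => hc x)
    have h2 := Finset.card_le_two (a := a) (b := b)
    simp only [Finset.card_univ, Fintype.card_fin] at this
    omega
  simp only [Finset.mem_insert, Finset.mem_singleton, not_or] at hb hc
  have h1 := h (strandPair a b (Ne.symm hb))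
  have h2 := h (strandPair a c (Ne.symm hc.1))
  rw [smul_strandPair, strandPair_eq_iff] at h1 h2
  rw [Equiv.Perm.one_apply]
  grind

/-- The semidirect product of the integral functions on the pairs by the symmetric group. -/
abbrev LinkingGroup (n : ℕ) : Type :=
  (StrandPair n → Multiplicative ℤ) ⋊[mulAutArrow] Equiv.Perm (Fin n)

theorem mulAutArrow_mulSingle {n : ℕ} (g : Equiv.Perm (Fin n)) (s : StrandPair n)
    (x : Multiplicative ℤ) :
    mulAutArrow g (Pi.mulSingle s x) = (Pi.mulSingle (g • s) x : StrandPair n → _) := by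
  ext1 r
  rw [mulAutArrow_apply_apply]
  change (Pi.mulSingle s x : StrandPair n → _) (g⁻¹ • r) = _
  simp only [Pi.mulSingle_apply, inv_smul_eq_iff]

/-- The images of the Artin generators in the linking group. -/
def linkingSeq (n i : ℕ) : LinkingGroup n :=
  if h : i + 1 < n then
    ⟨Pi.mulSingle (strandPair ⟨i, by omega⟩ ⟨i + 1, h⟩ (by simp)) (Multiplicative.ofAdd 1),
      adjSwap n i⟩
  else 1

theorem linkingSeq_of_lt {n i : ℕ} (h : i + 1 < n) : linkingSeq n i =
    ⟨Pi.mulSingle (strandPair ⟨i, by omega⟩ ⟨i + 1, h⟩ (by simp)) (Multiplicative.ofAdd 1),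
      adjSwap n i⟩ :=
  dif_pos h

theorem braidRelations_adjSwap (n : ℕ) : BraidRelations (adjSwap n) (n - 1) := by
  simpa only [braidPerm_braidSeq] using (braidRelations_braidSeq n).map (braidPerm n)

theorem adjSwap_apply {n i : ℕ} (h : i + 1 < n) (a : Fin n) :
    adjSwap n i a = if (a : ℕ) = i then ⟨i + 1, h⟩ else if (a : ℕ) = i + 1 then ⟨i, by omega⟩
      else a := by
  rw [adjSwap_of_lt h, Equiv.swap_apply_def]
  simp only [Fin.ext_iff]

/-- Distant transpositions fix each other's pair. In the braid relation both sides collect the three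
pairs from `i`, `i + 1`, `i + 2` once each, in opposite orders, which is harmless because the
coefficients commute. -/
theorem braidRelations_linkingSeq (n : ℕ) : BraidRelations (linkingSeq n) (n - 1) where
  comm i j hij hj := by
    rw [linkingSeq_of_lt (show i + 1 < n by omega), linkingSeq_of_lt (show j + 1 < n by omega)]
    refine SemidirectProduct.ext ?_ ((braidRelations_adjSwap n).comm i j hij hj)
    simp only [SemidirectProduct.mul_left, mulAutArrow_mulSingle, smul_strandPair]
    rw [mul_comm]
    congr 2
    · simp only [adjSwap_apply (show i + 1 < n by omega), strandPair_eq_iff, Fin.ext_iff]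
      grind
    · simp only [adjSwap_apply (show j + 1 < n by omega), strandPair_eq_iff, Fin.ext_iff]
      grind
  braid i hi := by
    rw [linkingSeq_of_lt (show i + 1 < n by omega), linkingSeq_of_lt (show i + 1 + 1 < n by omega)]
    refine SemidirectProduct.ext ?_ ((braidRelations_adjSwap n).braid i hi)
    simp only [SemidirectProduct.mul_left, SemidirectProduct.mul_right, mulAutArrow_mulSingle,
      smul_strandPair, Equiv.Perm.mul_apply]
    have key : ∀ p q r p' q' r' : StrandPair n, p = r' → q = q' → r = p' →
        (Pi.mulSingle p (Multiplicative.ofAdd 1) : StrandPair n → Multiplicative ℤ) *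
          Pi.mulSingle q (Multiplicative.ofAdd 1) * Pi.mulSingle r (Multiplicative.ofAdd 1) =
        Pi.mulSingle p' (Multiplicative.ofAdd 1) * Pi.mulSingle q' (Multiplicative.ofAdd 1) *
          Pi.mulSingle r' (Multiplicative.ofAdd 1) := by
      rintro p q r _ _ _ rfl rfl rfl
      rw [mul_rotate, mul_comm (Pi.mulSingle q _), mul_assoc]
    apply key <;>
    · simp only [adjSwap_apply (show i + 1 < n by omega),
        adjSwap_apply (show i + 1 + 1 < n by omega), strandPair_eq_iff, Fin.ext_iff]
      grind

/-- The homomorphism of the braid group that records the permutation and the linking numbers. -/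
def linkingHom (n : ℕ) : BraidGroup n →* LinkingGroup n :=
  braidLift (braidRelations_linkingSeq n)

theorem monoidHom_ext_braidSeq {K : Type*} [Group K] {n : ℕ} {f g : BraidGroup n →* K}
    (h : ∀ i, i + 1 < n → f (braidSeq n i) = g (braidSeq n i)) : f = g := by
  refine PresentedGroup.ext fun i => ?_
  have := h i (by omega)
  rwa [braidSeq, dif_pos i.2] at this

theorem linkingHom_braidSeq {n i : ℕ} (h : i + 1 < n) :
    linkingHom n (braidSeq n i) = linkingSeq n i :=
  braidLift_braidSeq _ (by omega)

theorem rightHom_linkingHom (n : ℕ) :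
    SemidirectProduct.rightHom.comp (linkingHom n) = braidPerm n := by
  refine monoidHom_ext_braidSeq fun i hi => ?_
  rw [MonoidHom.comp_apply, linkingHom_braidSeq hi, linkingSeq_of_lt hi, braidPerm_braidSeq]
  rfl

theorem linkingHom_right {n : ℕ} (g : BraidGroup n) : (linkingHom n g).right = braidPerm n g := by
  rw [← rightHom_linkingHom]
  rfl

/-- Pure braids land in the abelian normal factor of the semidirect product. -/
theorem commutator_le_ker_linkingHom (n : ℕ) :
    ⁅pureBraidGroup n, pureBraidGroup n⁆ ≤ (linkingHom n).ker := by
  rw [Subgroup.commutator_le]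
  intro x hx y hy
  rw [MonoidHom.mem_ker, map_commutatorElement, commutatorElement_eq_one_iff_mul_comm]
  have hx' : (linkingHom n x).right = 1 := (linkingHom_right x).trans hx
  have hy' : (linkingHom n y).right = 1 := (linkingHom_right y).trans hy
  apply SemidirectProduct.ext
  · simp [hx', hy', mul_comm]
  · simp [hx', hy']

/-- The homomorphism induced by the linking homomorphism on `B_n / [P_n, P_n]`. -/
def quotientLinking (n : ℕ) : BraidQuotient n →* LinkingGroup n :=
  QuotientGroup.lift _ (linkingHom n) (commutator_le_ker_linkingHom n)

/-- The permutation of an element of `B_n / [P_n, P_n]`. -/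
def quotientPerm (n : ℕ) : BraidQuotient n →* Equiv.Perm (Fin n) :=
  SemidirectProduct.rightHom.comp (quotientLinking n)

theorem quotientPerm_mk {n : ℕ} (g : BraidGroup n) :
    quotientPerm n (QuotientGroup.mk g) = braidPerm n g :=
  linkingHom_right g

theorem quotientPerm_surjective (n : ℕ) : Function.Surjective (quotientPerm n) := fun p => by
  obtain ⟨g, rfl⟩ := braidPerm_surjective n p
  exact ⟨_, quotientPerm_mk g⟩

/-- The images in `B_n / [P_n, P_n]` of the Artin generators, as a sequence. -/
def quotientSeq (n i : ℕ) : BraidQuotient n := QuotientGroup.mk (braidSeq n i)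

theorem braidRelations_quotientSeq (n : ℕ) : BraidRelations (quotientSeq n) (n - 1) :=
  (braidRelations_braidSeq n).map (QuotientGroup.mk' _)

theorem quotientPerm_quotientSeq (n i : ℕ) : quotientPerm n (quotientSeq n i) = adjSwap n i :=
  (quotientPerm_mk _).trans (braidPerm_braidSeq n i)

theorem initialClosure_quotientSeq (n : ℕ) : initialClosure (quotientSeq n) (n - 1) = ⊤ := by
  rw [← Subgroup.map_top_of_surjective (QuotientGroup.mk' ⁅pureBraidGroup n, pureBraidGroup n⁆)
    (QuotientGroup.mk'_surjective _), ← initialClosure_braidSeq, map_initialClosure]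
  rfl

theorem commute_of_quotientPerm_eq_one {n : ℕ} {x y : BraidQuotient n}
    (hx : quotientPerm n x = 1) (hy : quotientPerm n y = 1) : Commute x y := by
  induction x using QuotientGroup.induction_on with | H x =>
  induction y using QuotientGroup.induction_on with | H y =>
  rw [quotientPerm_mk] at hx hy
  rw [Commute, SemiconjBy, ← commutatorElement_eq_one_iff_mul_comm]
  exact (QuotientGroup.eq_one_iff _).mpr (Subgroup.commutator_mem_commutator hx hy)

/-! ### The kernel of the linking homomorphism -/

section Kernel

variable {n : ℕ}

/-- The square of the last Artin generator. -/
def lastTwist (n : ℕ) : BraidQuotient n := quotientSeq n (n - 2) * quotientSeq n (n - 2)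

theorem quotientPerm_lastTwist (n : ℕ) : quotientPerm n (lastTwist n) = 1 := by
  rw [lastTwist, map_mul, quotientPerm_quotientSeq, adjSwap_mul_self]

theorem isConj_quotientSeq_last {i : ℕ} (hi : i + 1 < n) :
    IsConj (quotientSeq n (n - 2)) (quotientSeq n i) := by
  obtain ⟨d, hd⟩ : ∃ d, i + d = n - 2 := ⟨n - 2 - i, by omega⟩
  induction d generalizing i with
  | zero => rw [← hd, add_zero]
  | succ d ih =>
    refine (ih (i := i + 1) (by omega) (by omega)).trans (IsConj.symm ?_)
    rw [isConj_iff]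
    -- The braid relation says exactly that this product conjugates the generator `i` to the
    -- generator `i + 1`.
    refine ⟨quotientSeq n i * quotientSeq n (i + 1), ?_⟩
    rw [mul_inv_eq_iff_eq_mul, ← (braidRelations_quotientSeq n).braid i (by omega)]
    simp only [mul_assoc]

/-- All generators are conjugate, so killing one square kills all of them. The quotient then
satisfies the Coxeter relations and maps injectively to the symmetric group. -/
theorem normalClosure_lastTwist : Subgroup.normalClosure {lastTwist n} = (quotientPerm n).ker := by
  apply le_antisymm
  · exact Subgroup.normalClosure_le_normal (by simpa using quotientPerm_lastTwist n)
  intro x hx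
  set N := Subgroup.normalClosure {lastTwist n}
  have hN : N ≤ (quotientPerm n).ker :=
    Subgroup.normalClosure_le_normal (by simpa using quotientPerm_lastTwist n)
  rw [← QuotientGroup.eq_one_iff]
  refine eq_one_of_mem_initialClosure (n := n)
    (t := fun i => (QuotientGroup.mk' N) (quotientSeq n i))
    (f := QuotientGroup.lift N (quotientPerm n) hN)
    ((braidRelations_quotientSeq n).map _) (fun i hi => ?_)
    (fun i hi => quotientPerm_quotientSeq n i) le_rfl ?_ hx
  · rw [← map_mul]
    refine (QuotientGroup.eq_one_iff _).mpr ?_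
    obtain ⟨u, hu⟩ := isConj_iff.mp (isConj_quotientSeq_last (n := n) (i := i) (by omega))
    have : quotientSeq n i * quotientSeq n i = u * lastTwist n * u⁻¹ := by
      rw [← hu, lastTwist]; group
    rw [this]
    exact Subgroup.normalClosure_normal.conj_mem _
      (Subgroup.subset_normalClosure (Set.mem_singleton _)) _
  · rw [← map_initialClosure, initialClosure_quotientSeq]
    exact Subgroup.mem_map_of_mem _ trivial

/-- A permutation fixing the last two points is a word in generators too far from the last one to
interact with it. The same word in the braid quotient differs from `g` by an element of the abelian
kernel, which contains `lastTwist n`. -/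
theorem commute_lastTwist_of_fixes (hn : 2 ≤ n) {g : BraidQuotient n}
    (h1 : quotientPerm n g ⟨n - 1, by omega⟩ = ⟨n - 1, by omega⟩)
    (h2 : quotientPerm n g ⟨n - 2, by omega⟩ = ⟨n - 2, by omega⟩) :
    Commute g (lastTwist n) := by
  have hmem : quotientPerm n g ∈ initialClosure (adjSwap n) (n - 3) := by
    have hstep : ∀ j, (hj : j + 1 < n) → quotientPerm n g ∈ initialClosure (adjSwap n) (j + 1) →
        quotientPerm n g ⟨j + 1, hj⟩ = ⟨j + 1, hj⟩ →
        quotientPerm n g ∈ initialClosure (adjSwap n) j := fun j hj hm hfix =>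
      mem_initialClosure_of_apply_eq (f := MonoidHom.id _) (braidRelations_adjSwap n)
        (fun i _ => adjSwap_mul_self n i) (fun i _ => rfl) hj hm hfix
    -- For `n = 2` the subtraction `n - 3` truncates to `0` and a single reduction suffices;
    -- otherwise two are needed.
    obtain rfl | ⟨k, rfl⟩ : n = 2 ∨ ∃ k, n = k + 3 := by
      rcases hn.eq_or_lt with h | h
      · exact Or.inl h.symm
      · exact Or.inr ⟨n - 3, by omega⟩
    · exact hstep 0 (by omega) (by rw [initialClosure_adjSwap 2]; trivial) h1
    · refine hstep k (by omega) (hstep (k + 1) (by omega) ?_ h1) h2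
      rw [show k + 1 + 1 = k + 3 - 1 by omega, initialClosure_adjSwap]
      trivial
  rw [show adjSwap n = fun i => quotientPerm n (quotientSeq n i) from
    funext fun i => (quotientPerm_quotientSeq n i).symm, ← map_initialClosure] at hmem
  obtain ⟨h, hh, hgh⟩ := hmem
  have hcomm : Commute h (lastTwist n) := by
    have : initialClosure (quotientSeq n) (n - 3) ≤ Subgroup.centralizer {lastTwist n} := by
      rw [initialClosure, Subgroup.closure_le]
      rintro _ ⟨i, hi, rfl⟩
      simp only [Set.mem_Iio] at hi
      rw [SetLike.mem_coe, Subgroup.mem_centralizer_singleton_iff]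
      have hc : Commute (quotientSeq n i) (quotientSeq n (n - 2)) :=
        (braidRelations_quotientSeq n).comm i (n - 2) (by omega) (by omega)
      exact (hc.mul_right hc).eq
    exact Subgroup.mem_centralizer_singleton_iff.mp (this hh)
  have hk : Commute (h⁻¹ * g) (lastTwist n) := by
    apply commute_of_quotientPerm_eq_one _ (quotientPerm_lastTwist n)
    rw [map_mul, map_inv, hgh, inv_mul_cancel]
  simpa using hcomm.mul_left hk

/-- The pair of the two last strands. -/
def lastPair (hn : 2 ≤ n) : StrandPair n :=
  strandPair ⟨n - 2, by omega⟩ ⟨n - 1, by omega⟩ (by simp; omega)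

/-- If `g` exchanges the last two strands, multiplying it by the last generator, which commutes with
its own square, reduces to the case where both are fixed. -/
theorem commute_lastTwist (hn : 2 ≤ n) {g : BraidQuotient n}
    (h : quotientPerm n g • lastPair hn = lastPair hn) : Commute g (lastTwist n) := by
  rw [lastPair, smul_strandPair, strandPair_eq_iff] at h
  rcases h with ⟨h1, h2⟩ | ⟨h1, h2⟩
  · exact commute_lastTwist_of_fixes hn h2 h1
  · have hc : Commute (quotientSeq n (n - 2)) (lastTwist n) :=
      (Commute.refl _).mul_right (Commute.refl _)
    have : Commute (g * quotientSeq n (n - 2)) (lastTwist n) := by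
      have e1 : adjSwap n (n - 2) ⟨n - 1, by omega⟩ = ⟨n - 2, by omega⟩ := by
        rw [adjSwap_apply (by omega)]
        grind
      have e2 : adjSwap n (n - 2) ⟨n - 2, by omega⟩ = ⟨n - 1, by omega⟩ := by
        rw [adjSwap_apply (by omega)]
        grind
      apply commute_lastTwist_of_fixes hn
      · rw [map_mul, Equiv.Perm.mul_apply, quotientPerm_quotientSeq, e1, h1]
      · rw [map_mul, Equiv.Perm.mul_apply, quotientPerm_quotientSeq, e2, h2]
    simpa using this.mul_left hc.inv_left

theorem exists_quotientPerm_smul_lastPair (hn : 2 ≤ n) (s : StrandPair n) :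
    ∃ g, quotientPerm n g • lastPair hn = s := by
  obtain ⟨a, b, hab, rfl⟩ := exists_strandPair s
  have h0 : (⟨n - 2, by omega⟩ : Fin n) ≠ ⟨n - 1, by omega⟩ := by simp; omega
  obtain ⟨p, h1, h2⟩ : ∃ p : Equiv.Perm (Fin n), p ⟨n - 2, by omega⟩ = a ∧
      p ⟨n - 1, by omega⟩ = b := by
    set x : Fin n := ⟨n - 2, by omega⟩
    set y : Fin n := ⟨n - 1, by omega⟩
    refine ⟨Equiv.swap (Equiv.swap x a y) b * Equiv.swap x a, ?_, ?_⟩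
    · rw [Equiv.Perm.mul_apply, Equiv.swap_apply_left, Equiv.swap_apply_of_ne_of_ne _ hab]
      intro h
      apply h0
      rw [Equiv.swap_apply_def] at h
      grind
    · rw [Equiv.Perm.mul_apply, Equiv.swap_apply_left]
  obtain ⟨g, rfl⟩ := quotientPerm_surjective n p
  exact ⟨g, by simp only [lastPair, smul_strandPair, h1, h2]⟩

/-- The class in `B_n / [P_n, P_n]` of the full twist of two strands. -/
noncomputable def pairTwist (hn : 2 ≤ n) (s : StrandPair n) : BraidQuotient n :=
  (exists_quotientPerm_smul_lastPair hn s).choose * lastTwist n *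
    (exists_quotientPerm_smul_lastPair hn s).choose⁻¹

/-- Two elements carrying the last pair to the same pair differ by a stabilizer element, which
commutes with the twist. Hence the choice made in `pairTwist` is immaterial. -/
theorem conj_lastTwist (hn : 2 ≤ n) (g : BraidQuotient n) :
    g * lastTwist n * g⁻¹ = pairTwist hn (quotientPerm n g • lastPair hn) := by
  set h := (exists_quotientPerm_smul_lastPair hn (quotientPerm n g • lastPair hn)).choose with hh
  have hspec : quotientPerm n h • lastPair hn = quotientPerm n g • lastPair hn :=
    (exists_quotientPerm_smul_lastPair hn (quotientPerm n g • lastPair hn)).choose_spec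
  have hc : Commute (h⁻¹ * g) (lastTwist n) := by
    apply commute_lastTwist hn
    rw [map_mul, mul_smul, ← hspec, ← mul_smul, map_inv, inv_mul_cancel, one_smul]
  rw [pairTwist, ← hh]
  have := hc.eq
  calc g * lastTwist n * g⁻¹ = h * ((h⁻¹ * g) * lastTwist n) * g⁻¹ := by group
    _ = h * lastTwist n * h⁻¹ := by rw [this]; group

theorem quotientPerm_pairTwist (hn : 2 ≤ n) (s : StrandPair n) :
    quotientPerm n (pairTwist hn s) = 1 := by
  simp [pairTwist, quotientPerm_lastTwist]

theorem closure_range_pairTwist (hn : 2 ≤ n) :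
    Subgroup.closure (Set.range (pairTwist hn)) = (quotientPerm n).ker := by
  apply le_antisymm
  · rw [Subgroup.closure_le]
    rintro _ ⟨s, rfl⟩
    exact quotientPerm_pairTwist hn s
  · rw [← normalClosure_lastTwist, Subgroup.normalClosure]
    apply Subgroup.closure_mono
    intro x hx
    obtain ⟨y, hy, hyx⟩ := Group.mem_conjugatesOfSet_iff.mp hx
    rw [Set.mem_singleton_iff] at hy
    subst hy
    obtain ⟨u, rfl⟩ := isConj_iff.mp hyx
    exact ⟨_, (conj_lastTwist hn u).symm⟩

theorem quotientLinking_quotientSeq {i : ℕ} (h : i + 1 < n) :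
    quotientLinking n (quotientSeq n i) = linkingSeq n i :=
  linkingHom_braidSeq h

/-- The last transposition preserves its own pair, so the two contributions of the square add up to
`2`. -/
theorem quotientLinking_lastTwist (hn : 2 ≤ n) :
    quotientLinking n (lastTwist n) = ⟨Pi.mulSingle (lastPair hn) (Multiplicative.ofAdd 2), 1⟩ := by
  rw [lastTwist, map_mul, quotientLinking_quotientSeq (by omega), linkingSeq_of_lt (by omega)]
  refine SemidirectProduct.ext ?_ (adjSwap_mul_self _ _)
  rw [SemidirectProduct.mul_left, mulAutArrow_mulSingle, smul_strandPair]
  have e : ∀ p q : StrandPair n, p = lastPair hn → q = lastPair hn →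
      (Pi.mulSingle p (Multiplicative.ofAdd 1) * Pi.mulSingle q (Multiplicative.ofAdd 1) :
        StrandPair n → Multiplicative ℤ) = Pi.mulSingle (lastPair hn) (Multiplicative.ofAdd 2) := by
    rintro _ _ rfl rfl
    rw [← Pi.mulSingle_mul]
    rfl
  apply e
  · simp only [lastPair, strandPair_eq_iff, Fin.ext_iff]
    grind
  · simp only [adjSwap_apply (show n - 2 + 1 < n by omega), lastPair, strandPair_eq_iff,
      Fin.ext_iff]
    grind

theorem quotientLinking_pairTwist (hn : 2 ≤ n) (s : StrandPair n) :
    quotientLinking n (pairTwist hn s) = ⟨Pi.mulSingle s (Multiplicative.ofAdd 2), 1⟩ := by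
  obtain ⟨g, rfl⟩ := exists_quotientPerm_smul_lastPair hn s
  rw [← conj_lastTwist, map_mul, map_mul, map_inv, quotientLinking_lastTwist hn]
  set w := quotientLinking n g with hw
  have hr : quotientPerm n g = w.right := rfl
  rw [hr, mul_inv_eq_iff_eq_mul]
  apply SemidirectProduct.ext
  · simp only [SemidirectProduct.mul_left, mulAutArrow_mulSingle, map_one, MulAut.one_apply]
    rw [mul_comm]
  · simp

theorem pairwise_commute_pairTwist (hn : 2 ≤ n) : Pairwise fun s s' => ∀ x y : Multiplicative ℤ,
    Commute (zpowersHom _ (pairTwist hn s) x) (zpowersHom _ (pairTwist hn s') y) := by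
  intro s s' _ x y
  apply commute_of_quotientPerm_eq_one <;> simp [zpowersHom_apply, quotientPerm_pairTwist]

/-- The integral combinations of the twists of pairs of strands. -/
noncomputable def twistHom (hn : 2 ≤ n) :
    (StrandPair n → Multiplicative ℤ) →* BraidQuotient n :=
  MonoidHom.noncommPiCoprod (fun s => zpowersHom _ (pairTwist hn s))
    (pairwise_commute_pairTwist hn)

theorem range_twistHom (hn : 2 ≤ n) : (twistHom hn).range = (quotientPerm n).ker := by
  rw [twistHom, MonoidHom.noncommPiCoprod_range, ← closure_range_pairTwist hn,
    ← Set.iUnion_singleton_eq_range, Subgroup.closure_iUnion]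
  congr 1
  ext1 s
  rw [← Subgroup.zpowers_eq_closure]
  ext x
  simp [Subgroup.mem_zpowers_iff, zpowersHom_apply]

theorem quotientLinking_twistHom (hn : 2 ≤ n) (w : StrandPair n → Multiplicative ℤ) :
    quotientLinking n (twistHom hn w) = ⟨w ^ 2, 1⟩ := by
  have : (quotientLinking n).comp (twistHom hn) =
      SemidirectProduct.inl.comp (powMonoidHom 2) := by
    refine MonoidHom.pi_ext fun s x => ?_
    rw [MonoidHom.comp_apply, twistHom, MonoidHom.noncommPiCoprod_mulSingle, zpowersHom_apply,
      map_zpow, quotientLinking_pairTwist]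
    change (SemidirectProduct.inl (Pi.mulSingle s (Multiplicative.ofAdd 2)) :
      LinkingGroup n) ^ _ = _
    rw [← map_zpow, MonoidHom.comp_apply, powMonoidHom_apply, ← Pi.mulSingle_zpow,
      ← Pi.mulSingle_pow]
    congr 2
    apply Multiplicative.toAdd.injective
    simp [mul_comm]
  exact DFunLike.congr_fun this w

/-- A kernel element is pure, hence an integral combination `w` of twists. Its image is `w ^ 2`, and
the integers have no torsion. -/
theorem quotientLinking_injective (hn : 2 ≤ n) : Function.Injective (quotientLinking n) := by
  rw [injective_iff_map_eq_one]
  intro x hx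
  have hx' : x ∈ (quotientPerm n).ker := by
    rw [MonoidHom.mem_ker, quotientPerm, MonoidHom.comp_apply, hx, map_one]
  rw [← range_twistHom hn] at hx'
  obtain ⟨w, rfl⟩ := hx'
  rw [quotientLinking_twistHom] at hx
  have hw : w ^ 2 = 1 := congrArg SemidirectProduct.left hx
  have : w = 1 := by
    ext1 s
    have h2 := congrArg Multiplicative.toAdd (congrFun hw s)
    apply Multiplicative.toAdd.injective
    simpa using h2
  rw [this, map_one]

end Kernel

/-! ### Monomial groups are crystallographic -/

/-- A torsion-free group `Γ` of monomial affine transformations of `ℤ^I`, with a finite index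
lattice of translations and the point group `Φ`. -/
structure LatticeData (I Φ Γ : Type*) [Group Φ] [Group Γ] where
  /-- The translation part. -/
  shift : Γ → I → ℤ
  /-- The linear part. -/
  perm : Γ →* Equiv.Perm I
  /-- The projection to the holonomy group. -/
  hol : Γ →* Φ
  shift_mul : ∀ g h k, shift (g * h) k = shift g k + shift h ((perm g)⁻¹ k)
  eq_one : ∀ g, perm g = 1 → shift g = 0 → g = 1
  hol_surjective : Function.Surjective hol
  hol_eq_one_iff : ∀ g, hol g = 1 ↔ perm g = 1
  /-- All translations that are divisible by this integer lie in the group. -/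
  modulus : ℕ
  modulus_pos : 0 < modulus
  exists_translation : ∀ w : I → ℤ, ∃ g, perm g = 1 ∧ shift g = fun k => (modulus : ℤ) * w k
  torsionFree : ∀ g : Γ, IsOfFinOrder g → g = 1

namespace LatticeData

/-! ### Transport and products of monomial groups -/

section Basic

variable {I Φ Γ : Type*} [Group Φ] [Group Γ] (D : LatticeData I Φ Γ)

theorem shift_one : D.shift 1 = 0 := by
  funext k
  have := D.shift_mul 1 1 k
  simpa using this

/-- Transport along a bijection of the index types. -/
def reindex {J : Type*} (e : I ≃ J) : LatticeData J Φ Γ where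
  shift g k := D.shift g (e.symm k)
  perm := (e.permCongrHom : Equiv.Perm I →* Equiv.Perm J).comp D.perm
  hol := D.hol
  shift_mul g h k := by
    have : e.symm ((e.permCongrHom (D.perm g))⁻¹ k) = (D.perm g)⁻¹ (e.symm k) :=
      e.symm_apply_apply _
    rw [D.shift_mul]
    exact congrArg (fun j => _ + D.shift h j) this.symm
  eq_one g h1 h2 := D.eq_one g ((map_eq_one_iff _ e.permCongrHom.injective).mp h1) (by
    funext k
    simpa using congrFun h2 (e k))
  hol_surjective := D.hol_surjective
  hol_eq_one_iff g :=
    (D.hol_eq_one_iff g).trans (map_eq_one_iff _ e.permCongrHom.injective).symm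
  modulus := D.modulus
  modulus_pos := D.modulus_pos
  exists_translation w := by
    obtain ⟨g, h1, h2⟩ := D.exists_translation (w ∘ e)
    exact ⟨g, (map_eq_one_iff _ e.permCongrHom.injective).mpr h1, by funext k; simp [h2]⟩
  torsionFree := D.torsionFree

/-- Transport along an isomorphism of groups. -/
def congr {Γ' : Type*} [Group Γ'] (e : Γ' ≃* Γ) : LatticeData I Φ Γ' where
  shift g := D.shift (e g)
  perm := D.perm.comp (e : Γ' →* Γ)
  hol := D.hol.comp (e : Γ' →* Γ)
  shift_mul g h k := by simp [D.shift_mul]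
  eq_one g h1 h2 := by simpa using D.eq_one (e g) h1 h2
  hol_surjective := D.hol_surjective.comp e.surjective
  hol_eq_one_iff g := D.hol_eq_one_iff (e g)
  modulus := D.modulus
  modulus_pos := D.modulus_pos
  exists_translation w := by
    obtain ⟨g, h1, h2⟩ := D.exists_translation w
    exact ⟨e.symm g, by simp [h1], by simp [h2]⟩
  torsionFree g hg := by
    simpa using D.torsionFree (e g) ((e : Γ' →* Γ).isOfFinOrder hg)

/-- The product of finitely many monomial groups. -/
def pi {ι : Type*} [Fintype ι] {I Γ : ι → Type*} [∀ i, Group (Γ i)] {A : ι → Type*}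
    [∀ i, AddGroup (A i)] (D : ∀ i, LatticeData (I i) (Multiplicative (A i)) (Γ i)) :
    LatticeData (Σ i, I i) (Multiplicative (∀ i, A i)) (∀ i, Γ i) where
  shift g k := (D k.1).shift (g k.1) k.2
  perm := (Equiv.Perm.sigmaCongrRightHom I).comp
    (MonoidHom.pi fun i => (D i).perm.comp (Pi.evalMonoidHom _ i))
  hol :=
    { toFun g := Multiplicative.ofAdd fun i => Multiplicative.toAdd ((D i).hol (g i))
      map_one' := by
        apply Multiplicative.toAdd.injective
        funext i
        simp
      map_mul' g h := by
        apply Multiplicative.toAdd.injective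
        funext i
        simp }
  shift_mul g h k := by
    obtain ⟨i, k⟩ := k
    exact (D i).shift_mul _ _ _
  eq_one g h1 h2 := by
    funext i
    refine (D i).eq_one _ ?_ ?_
    · ext k
      have := DFunLike.congr_fun h1 ⟨i, k⟩
      simpa using this
    · funext k
      exact congrFun h2 ⟨i, k⟩
  hol_surjective x := by
    choose g hg using fun i =>
      (D i).hol_surjective (Multiplicative.ofAdd (Multiplicative.toAdd x i))
    refine ⟨g, ?_⟩
    apply Multiplicative.toAdd.injective
    funext i
    simp [hg]
  hol_eq_one_iff g := by
    have h1 : (Equiv.Perm.sigmaCongrRightHom I).comp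
        (MonoidHom.pi fun i => (D i).perm.comp (Pi.evalMonoidHom _ i)) g = 1 ↔
        ∀ i, (D i).perm (g i) = 1 := by
      rw [MonoidHom.comp_apply, map_eq_one_iff _ Equiv.Perm.sigmaCongrRightHom_injective]
      exact funext_iff
    rw [h1]
    simp only [← (D _).hol_eq_one_iff]
    exact funext_iff
  modulus := ∏ i, (D i).modulus
  modulus_pos := Finset.prod_pos fun i _ => (D i).modulus_pos
  exists_translation w := by
    classical
    -- The common modulus is the product of all moduli; the factor `i` supplies its own, so the
    -- vector requested there carries the others.
    choose g h1 h2 using fun i => (D i).exists_translation fun k =>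
      ((∏ j ∈ Finset.univ.erase i, (D j).modulus : ℕ) : ℤ) * w ⟨i, k⟩
    refine ⟨g, ?_, ?_⟩
    · ext1 ⟨i, k⟩
      simp [h1]
    · funext ⟨i, k⟩
      simp only [h2]
      rw [← mul_assoc, ← Nat.cast_mul, Finset.mul_prod_erase _ (fun i => (D i).modulus)
        (Finset.mem_univ i)]
  torsionFree g hg := by
    funext i
    exact (D i).torsionFree _ ((Pi.evalMonoidHom Γ i).isOfFinOrder hg)

end Basic

/-! #### The holonomy group -/

section Holonomy

variable {d : ℕ} {Φ Γ : Type*} [Group Φ] [Group Γ] (D : LatticeData (Fin d) Φ Γ)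

theorem shift_mul_of_perm_eq_one {g : Γ} (hg : D.perm g = 1) (h : Γ) :
    D.shift (g * h) = D.shift g + D.shift h := by
  funext k
  rw [D.shift_mul, hg]
  simp

/-- The translation vector of an element of the translation subgroup. -/
def translationVector : D.perm.ker →* Multiplicative (Fin d → ℤ) where
  toFun g := Multiplicative.ofAdd (D.shift g)
  map_one' := by simp [D.shift_one]
  map_mul' g h := by
    simp [D.shift_mul_of_perm_eq_one g.2]

/-- The lattice of translation vectors. -/
def lattice : Submodule ℤ (Fin d → ℤ) :=
  AddSubgroup.toIntSubmodule (Subgroup.toAddSubgroup' D.translationVector.range)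

theorem mem_lattice {w : Fin d → ℤ} : w ∈ D.lattice ↔ ∃ g, D.perm g = 1 ∧ D.shift g = w := by
  constructor
  · rintro ⟨g, hg⟩
    exact ⟨g, g.2, hg⟩
  · rintro ⟨g, h1, h2⟩
    exact ⟨⟨g, h1⟩, h2⟩

/-- The lattice is squeezed between `ℤ^d` and its multiple by the modulus, both of rank `d`. -/
theorem finrank_lattice : Module.finrank ℤ D.lattice = d := by
  apply le_antisymm
  · simpa using Submodule.finrank_le D.lattice
  · let f : (Fin d → ℤ) →ₗ[ℤ] D.lattice :=
      LinearMap.codRestrict D.lattice ((D.modulus : ℤ) • LinearMap.id) fun w =>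
        D.mem_lattice.mpr (D.exists_translation w)
    have hf : Function.Injective f := by
      intro v w hvw
      have h1 := congrArg Subtype.val hvw
      funext k
      have h2 := congrFun h1 k
      have h3 := D.modulus_pos.ne'
      simpa [f, h3] using h2
    simpa using LinearMap.finrank_le_finrank_of_injective hf

/-- The translation subgroup is isomorphic to the lattice of translation vectors. -/
noncomputable def latticeEquiv : D.perm.ker ≃* Multiplicative D.lattice :=
  MulEquiv.ofBijective
    ({ toFun g := Multiplicative.ofAdd ⟨D.shift g, D.mem_lattice.mpr ⟨g, g.2, rfl⟩⟩
       map_one' := by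
        apply Multiplicative.toAdd.injective
        exact Subtype.ext D.shift_one
       map_mul' g h := by
        apply Multiplicative.toAdd.injective
        exact Subtype.ext (D.shift_mul_of_perm_eq_one g.2 h) } :
      D.perm.ker →* Multiplicative D.lattice) <| by
    constructor
    · rw [injective_iff_map_eq_one]
      intro g hg
      exact Subtype.ext (D.eq_one g g.2 (congrArg Subtype.val (congrArg Multiplicative.toAdd hg)))
    · intro w
      obtain ⟨g, h1, h2⟩ := D.mem_lattice.mp (Multiplicative.toAdd w).2
      exact ⟨⟨g, h1⟩, Multiplicative.toAdd.injective (Subtype.ext h2)⟩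

/-- The translation subgroup is free abelian of rank `d`. -/
noncomputable def kerPermEquiv : D.perm.ker ≃* Multiplicative (Fin d → ℤ) :=
  D.latticeEquiv.trans (AddEquiv.toMultiplicative
    (Module.finBasisOfFinrankEq ℤ D.lattice D.finrank_lattice).equivFun.toAddEquiv)

/-- The extension of the holonomy group by the translation subgroup. -/
noncomputable def extension : GroupExtension (Multiplicative (Fin d → ℤ)) Γ Φ where
  inl := D.perm.ker.subtype.comp (D.kerPermEquiv.symm : _ →* D.perm.ker)
  rightHom := D.hol
  inl_injective := D.perm.ker.subtype_injective.comp D.kerPermEquiv.symm.injective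
  range_inl_eq_ker_rightHom := by
    rw [MonoidHom.range_comp, MonoidHom.range_eq_top.mpr D.kerPermEquiv.symm.surjective,
      ← MonoidHom.range_eq_map, Subgroup.range_subtype]
    ext g
    exact (D.hol_eq_one_iff g).symm
  rightHom_surjective := D.hol_surjective

/-- Conjugation permutes the coordinates of a translation vector, so a multiple of the basis vector
at `i` detects whether `i` is moved. -/
theorem perm_eq_one_of_commute {g : Γ} (hg : ∀ h, D.perm h = 1 → g * h * g⁻¹ = h) :
    D.perm g = 1 := by
  rw [← inv_eq_one]
  refine Equiv.ext fun i => ?_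
  obtain ⟨h, h1, h2⟩ := D.exists_translation (Pi.single i 1)
  have h3 : D.shift (g * h) i = D.shift (h * g) i := by
    rw [mul_inv_eq_iff_eq_mul.mp (hg h h1)]
  rw [D.shift_mul, D.shift_mul, h1, h2, inv_one, Equiv.Perm.one_apply, add_comm,
    add_right_cancel_iff] at h3
  have h4 := D.modulus_pos.ne'
  by_contra hne
  rw [Equiv.Perm.one_apply] at hne
  beta_reduce at h3
  rw [Pi.single_eq_of_ne hne, Pi.single_eq_same] at h3
  omega

theorem hasHolonomyGroup [Finite Φ] (D : LatticeData (Fin d) Φ Γ) : HasHolonomyGroup d Φ Γ := by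
  refine ⟨inferInstance, D.extension, ?_⟩
  -- Translations commute with one another, so conjugation descends to the holonomy group.
  have hker : D.hol.ker ≤ D.extension.conjAct.ker := by
    intro g hg
    obtain ⟨x, rfl⟩ : g ∈ D.extension.inl.range := by
      rw [D.extension.range_inl_eq_ker_rightHom]
      exact hg
    rw [MonoidHom.mem_ker]
    ext1 y
    apply D.extension.inl_injective
    rw [D.extension.inl_conjAct_comm, MulAut.one_apply, ← map_inv, ← map_mul, ← map_mul,
      mul_comm x y, mul_inv_cancel_right]
  obtain ⟨Θ, hΘ⟩ : ∃ Θ : Φ →* MulAut (Multiplicative (Fin d → ℤ)),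
      ∀ g, Θ (D.hol g) = D.extension.conjAct g :=
    ⟨D.hol.liftOfSurjective D.hol_surjective ⟨D.extension.conjAct, hker⟩,
      MonoidHom.liftOfRightInverse_comp_apply _ _ _ _⟩
  refine ⟨Θ, fun g x => ?_, ?_⟩
  · rw [show D.extension.rightHom g = D.hol g from rfl, hΘ]
    exact D.extension.inl_conjAct_comm
  · rw [injective_iff_map_eq_one]
    intro a ha
    obtain ⟨g, rfl⟩ := D.hol_surjective a
    rw [hΘ] at ha
    rw [D.hol_eq_one_iff]
    apply D.perm_eq_one_of_commute
    intro h hh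
    obtain ⟨x, rfl⟩ : h ∈ D.extension.inl.range := by
      rw [D.extension.range_inl_eq_ker_rightHom]
      exact (D.hol_eq_one_iff h).mpr hh
    rw [← D.extension.inl_conjAct_comm, ha, MulAut.one_apply]

end Holonomy

end LatticeData

/-! ### Discrete and cocompact groups of rigid motions -/

section Motions

theorem orthogonalAction_apply {d : ℕ} (A : Matrix.orthogonalGroup (Fin d) ℝ)
    (v : Multiplicative (Fin d → ℝ)) :
    orthogonalAction d A v = Multiplicative.ofAdd (A.1.mulVec (Multiplicative.toAdd v)) := rfl

instance compactSpace_orthogonalGroup (d : ℕ) :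
    CompactSpace (Matrix.orthogonalGroup (Fin d) ℝ) := by
  refine isCompact_iff_compactSpace.mp ?_
  have hc : IsCompact (Set.pi Set.univ fun _ : Fin d => Set.pi Set.univ fun _ : Fin d =>
      Set.Icc (-1 : ℝ) 1) :=
    isCompact_univ_pi fun _ => isCompact_univ_pi fun _ => isCompact_Icc
  refine IsCompact.of_isClosed_subset (X := Matrix (Fin d) (Fin d) ℝ) hc isClosed_unitary ?_
  intro A hA i _ j _
  exact abs_le.mp (entry_norm_bound_of_unitary hA i j)

/-- The orthogonal matrix of a permutation of the coordinates. -/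
noncomputable def orthogonalPerm (d : ℕ) :
    Equiv.Perm (Fin d) →* Matrix.orthogonalGroup (Fin d) ℝ :=
  Matrix.permMatrixHom.codRestrict (Matrix.orthogonalGroup (Fin d) ℝ) fun p => by
    rw [Matrix.mem_orthogonalGroup_iff, Matrix.permMatrixHom_apply, Matrix.transpose_permMatrix,
      ← Matrix.permMatrix_mul, inv_mul_cancel, Matrix.permMatrix_one]

theorem orthogonalPerm_coe {d : ℕ} (p : Equiv.Perm (Fin d)) :
    (orthogonalPerm d p : Matrix (Fin d) (Fin d) ℝ) = p⁻¹.permMatrix ℝ := rfl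

theorem isEmbedding_euclideanMotion (d : ℕ) : Topology.IsEmbedding
    (fun g => (Multiplicative.toAdd g.left, g.right) :
      EuclideanMotion d → (Fin d → ℝ) × Matrix.orthogonalGroup (Fin d) ℝ) := by
  refine ⟨⟨rfl⟩, ?_⟩
  intro g h hgh
  exact SemidirectProduct.ext (congrArg Prod.fst hgh) (congrArg Prod.snd hgh)

theorem isEmbedding_intMatrix (d : ℕ) : Topology.IsEmbedding
    (fun p => (fun k => (p.1 k : ℝ), Matrix.of fun i j => (p.2 i j : ℝ)) :
      (Fin d → ℤ) × (Fin d → Fin d → ℤ) → (Fin d → ℝ) × Matrix (Fin d) (Fin d) ℝ) :=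
  (Topology.IsEmbedding.piMap fun _ => Int.isClosedEmbedding_coe_real.isEmbedding).prodMap
    (Topology.IsEmbedding.piMap fun _ =>
      Topology.IsEmbedding.piMap fun _ => Int.isClosedEmbedding_coe_real.isEmbedding)

/-! ### Representation by rigid motions -/

namespace LatticeData

variable {d : ℕ} {Φ Γ : Type*} [Group Φ] [Group Γ] (D : LatticeData (Fin d) Φ Γ)

/-- The representation by rigid motions. -/
noncomputable def motion : Γ →* EuclideanMotion d where
  toFun g := ⟨Multiplicative.ofAdd fun k => (D.shift g k : ℝ), orthogonalPerm d (D.perm g)⟩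
  map_one' := by
    refine SemidirectProduct.ext ?_ (by simp)
    apply Multiplicative.toAdd.injective
    funext k
    simp [D.shift_one]
  map_mul' g h := by
    refine SemidirectProduct.ext ?_ (by simp)
    apply Multiplicative.toAdd.injective
    funext k
    simp [D.shift_mul, orthogonalAction_apply, orthogonalPerm_coe, Matrix.permMatrix_mulVec]

theorem motion_left (g : Γ) (k : Fin d) :
    Multiplicative.toAdd (D.motion g).left k = (D.shift g k : ℝ) := rfl

theorem motion_right (g : Γ) : (D.motion g).right = orthogonalPerm d (D.perm g) := rfl

theorem motion_injective : Function.Injective D.motion := by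
  rw [injective_iff_map_eq_one]
  intro g hg
  have h1 : orthogonalPerm d (D.perm g) = 1 := congrArg SemidirectProduct.right hg
  refine D.eq_one g ?_ ?_
  · rw [← inv_eq_one]
    ext1 k
    -- A vector with distinct coordinates recovers the permutation from its matrix.
    have h2 : ((D.perm g)⁻¹.permMatrix ℝ).mulVec (fun i => ((i : ℕ) : ℝ)) k = (k : ℕ) := by
      rw [← orthogonalPerm_coe, h1]
      simp
    rw [Matrix.permMatrix_mulVec, Function.comp_apply] at h2
    exact Fin.ext (by exact_mod_cast h2)
  · funext k
    have h2 := D.motion_left g k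
    rw [hg] at h2
    simpa using h2.symm

/-- Translation vectors and permutation matrices have integer entries, so the embedding into real
data factors through a discrete space. -/
theorem discreteTopology_range : DiscreteTopology D.motion.range := by
  let F : D.motion.range → (Fin d → ℝ) × Matrix (Fin d) (Fin d) ℝ := fun g =>
    (Multiplicative.toAdd g.1.left, g.1.right.1)
  have hF : Topology.IsEmbedding F :=
    ((Topology.IsEmbedding.id.prodMap Topology.IsEmbedding.subtypeVal).comp
      (isEmbedding_euclideanMotion d)).comp Topology.IsEmbedding.subtypeVal
  have hlift : ∀ g : D.motion.range, ∃ p : (Fin d → ℤ) × (Fin d → Fin d → ℤ),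
      ((fun k => (p.1 k : ℝ), Matrix.of fun i j => (p.2 i j : ℝ)) :
        (Fin d → ℝ) × Matrix (Fin d) (Fin d) ℝ) = F g := by
    rintro ⟨_, g, rfl⟩
    refine ⟨(D.shift g, fun i j => (D.perm g)⁻¹.permMatrix ℤ i j), ?_⟩
    refine Prod.ext rfl ?_
    change _ = (orthogonalPerm d (D.perm g)).1
    rw [orthogonalPerm_coe]
    ext i j
    simp [Equiv.Perm.permMatrix, PEquiv.toMatrix_apply]
  choose G hG using hlift
  have hG' := funext hG
  rw [← hG'] at hF
  exact ((isEmbedding_intMatrix d).of_comp_iff.mp hF).discreteTopology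

theorem compactSpace_quotient : CompactSpace (EuclideanMotion d ⧸ D.motion.range) := by
  -- In the form `(A v, A)`, right multiplication by a translation `s` becomes `v ↦ v + s` whatever
  -- `A` is. So the compact set of a cube of side `D.modulus` times the orthogonal group meets every
  -- coset.
  let m : (Fin d → ℝ) × Matrix.orthogonalGroup (Fin d) ℝ → EuclideanMotion d := fun p =>
    ⟨Multiplicative.ofAdd (p.2.1.mulVec p.1), p.2⟩
  have hm : Continuous m := by
    rw [(isEmbedding_euclideanMotion d).continuous_iff]
    change Continuous fun p : (Fin d → ℝ) × Matrix.orthogonalGroup (Fin d) ℝ =>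
      (p.2.1.mulVec p.1, p.2)
    fun_prop
  let Q : Set ((Fin d → ℝ) × Matrix.orthogonalGroup (Fin d) ℝ) :=
    (Set.pi Set.univ fun _ => Set.Icc (0 : ℝ) D.modulus) ×ˢ Set.univ
  have hQ : IsCompact Q := (isCompact_univ_pi fun _ => isCompact_Icc).prod isCompact_univ
  have hc : Continuous fun p => (m p : EuclideanMotion d ⧸ D.motion.range) :=
    continuous_quotient_mk'.comp hm
  refine ⟨?_⟩
  convert hQ.image hc
  symm
  rw [Set.eq_univ_iff_forall]
  intro x
  induction x using QuotientGroup.induction_on with | H g =>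
  have hN : (0 : ℝ) < D.modulus := by exact_mod_cast D.modulus_pos
  let w : Fin d → ℝ := (g.right⁻¹).1.mulVec (Multiplicative.toAdd g.left)
  have hw : g.right.1.mulVec w = Multiplicative.toAdd g.left := by
    rw [Matrix.mulVec_mulVec, ← Submonoid.coe_mul, mul_inv_cancel, OneMemClass.coe_one,
      Matrix.one_mulVec]
  obtain ⟨γ, h1, h2⟩ := D.exists_translation fun k => -⌊w k / D.modulus⌋
  let u : Fin d → ℝ := fun k => w k + D.shift γ k
  have hu : ∀ k, u k = D.modulus * Int.fract (w k / D.modulus) := by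
    intro k
    simp only [u, h2, Int.fract]
    push_cast
    field_simp
    ring
  refine ⟨(u, g.right), ⟨?_, trivial⟩, ?_⟩
  · intro k _
    change 0 ≤ u k ∧ u k ≤ D.modulus
    rw [hu]
    exact ⟨mul_nonneg hN.le (Int.fract_nonneg _),
      mul_le_of_le_one_right hN.le (Int.fract_lt_one _).le⟩
  · have : m (u, g.right) = g * D.motion γ := by
      refine SemidirectProduct.ext ?_ ?_
      · apply Multiplicative.toAdd.injective
        change g.right.1.mulVec (w + fun k => (D.shift γ k : ℝ)) = _
        rw [Matrix.mulVec_add, hw]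
        rfl
      · rw [SemidirectProduct.mul_right, motion_right, h1, map_one, mul_one]
    change (m (u, g.right) : EuclideanMotion d ⧸ D.motion.range) = _
    rw [this]
    exact QuotientGroup.mk_mul_of_mem g ⟨γ, rfl⟩

theorem isCrystallographic (D : LatticeData (Fin d) Φ Γ) : IsCrystallographic d Γ :=
  ⟨D.motion.range, D.discreteTopology_range, D.compactSpace_quotient,
    ⟨MonoidHom.ofInjective D.motion_injective⟩⟩

theorem isBieberbach {I Φ Γ : Type*} [Fintype I] [Group Φ] [Finite Φ] [Group Γ]
    (D : LatticeData I Φ Γ) {d : ℕ} (hd : Fintype.card I = d) : IsBieberbach d Φ Γ where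
  crystallographic := (D.reindex (Fintype.equivFinOfCardEq hd)).isCrystallographic
  torsionFree := D.torsionFree
  holonomy := (D.reindex (Fintype.equivFinOfCardEq hd)).hasHolonomyGroup

end LatticeData

end Motions

/-! ### The cyclic Bieberbach subgroup -/

section Cyclic

variable {n : ℕ}

/-- The linking number of a pair of strands (twice the usual one for pure braids). -/
def linkingNumber (g : BraidQuotient n) (s : StrandPair n) : ℤ :=
  Multiplicative.toAdd ((quotientLinking n g).left s)

theorem linkingNumber_mul (g h : BraidQuotient n) (s : StrandPair n) :
    linkingNumber (g * h) s = linkingNumber g s + linkingNumber h ((quotientPerm n g)⁻¹ • s) := by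
  simp only [linkingNumber, map_mul, SemidirectProduct.mul_left]
  rfl

theorem eq_one_of_linkingNumber (hn : 2 ≤ n) {g : BraidQuotient n} (h1 : quotientPerm n g = 1)
    (h2 : ∀ s, linkingNumber g s = 0) : g = 1 := by
  apply quotientLinking_injective hn
  rw [map_one]
  refine SemidirectProduct.ext ?_ h1
  funext s
  exact Multiplicative.toAdd.injective (h2 s)

theorem linkingNumber_twistHom (hn : 2 ≤ n) (w : StrandPair n → ℤ) (s : StrandPair n) :
    linkingNumber (twistHom hn fun s => Multiplicative.ofAdd (w s)) s = 2 * w s := by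
  rw [linkingNumber, quotientLinking_twistHom]
  simp

theorem quotientPerm_twistHom (hn : 2 ≤ n) (w : StrandPair n → Multiplicative ℤ) :
    quotientPerm n (twistHom hn w) = 1 := by
  rw [quotientPerm, MonoidHom.comp_apply, quotientLinking_twistHom]
  rfl

/-- The exponent sum of an element of `B_n / [P_n, P_n]`. -/
def exponentSum (n : ℕ) : BraidQuotient n →* Multiplicative ℤ where
  toFun g := Multiplicative.ofAdd (∑ s, linkingNumber g s)
  map_one' := by simp [linkingNumber]
  map_mul' g h := by
    rw [← ofAdd_add]
    simp only [linkingNumber_mul, Finset.sum_add_distrib]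
    congr 2
    exact Equiv.sum_comp (MulAction.toPerm (quotientPerm n g)⁻¹) (linkingNumber h)

theorem exponentSum_quotientSeq {i : ℕ} (hi : i + 1 < n) :
    exponentSum n (quotientSeq n i) = Multiplicative.ofAdd 1 := by
  apply Multiplicative.toAdd.injective
  simp only [exponentSum, linkingNumber, quotientLinking_quotientSeq hi, linkingSeq_of_lt hi,
    MonoidHom.coe_mk, OneHom.coe_mk, toAdd_ofAdd]
  rw [Finset.sum_eq_single_of_mem _ (Finset.mem_univ _) fun s _ hs => by
    rw [Pi.mulSingle_eq_of_ne hs, toAdd_one]]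
  rw [Pi.mulSingle_eq_same, toAdd_ofAdd]

/-- The product of the first `k` generators, in increasing order. -/
def ascProd (n : ℕ) : ℕ → BraidQuotient n
  | 0 => 1
  | k + 1 => ascProd n k * quotientSeq n k

theorem exponentSum_ascProd {k : ℕ} (hk : k ≤ n - 1) :
    exponentSum n (ascProd n k) = Multiplicative.ofAdd (k : ℤ) := by
  induction k with
  | zero => simp [ascProd]
  | succ k ih =>
    rw [ascProd, map_mul, ih (by omega), exponentSum_quotientSeq (by omega), ← ofAdd_add]
    push_cast
    rfl

theorem quotientPerm_ascProd {k : ℕ} (hk : k ≤ n - 1) (a : Fin n) :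
    (quotientPerm n (ascProd n k) a : ℕ) =
      if (a : ℕ) < k then (a : ℕ) + 1 else if (a : ℕ) = k then 0 else a := by
  induction k generalizing a with
  | zero =>
    simp only [ascProd, map_one, Equiv.Perm.one_apply]
    grind
  | succ k ih =>
    rw [ascProd, map_mul, Equiv.Perm.mul_apply, ih (by omega), quotientPerm_quotientSeq,
      adjSwap_apply (show k + 1 < n by omega)]
    grind

theorem quotientPerm_ascProd_last (n : ℕ) :
    quotientPerm n (ascProd n (n - 1)) = finRotate n := by
  obtain _ | n := n
  · exact Subsingleton.elim _ _
  ext a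
  rw [quotientPerm_ascProd le_rfl, coe_finRotate]
  grind [Fin.ext_iff]

/-- The permutation together with the exponent sum modulo `n`. -/
def permExponent (n : ℕ) : BraidQuotient n →* Equiv.Perm (Fin n) × Multiplicative (ZMod n) :=
  (quotientPerm n).prod ((AddMonoidHom.toMultiplicative (Int.castAddHom (ZMod n))).comp
    (exponentSum n))

theorem permExponent_snd (g : BraidQuotient n) : (permExponent n g).2 =
    Multiplicative.ofAdd ((Multiplicative.toAdd (exponentSum n g) : ℤ) : ZMod n) := rfl

/-- The elements of `B_n / [P_n, P_n]` over the powers of an `n`-cycle whose exponent sum is the one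
prescribed, modulo `n`, by the permutation. -/
def cyclicSubgroup (n : ℕ) : Subgroup (BraidQuotient n) :=
  -- The value `-1` is forced by the lift `ascProd n (n - 1)` of the cycle, which has `n - 1`
  -- letters.
  (Subgroup.zpowers (finRotate n, Multiplicative.ofAdd (-1 : ZMod n))).comap (permExponent n)

theorem mem_cyclicSubgroup {g : BraidQuotient n} : g ∈ cyclicSubgroup n ↔
    ∃ j : ℤ, quotientPerm n g = finRotate n ^ j ∧
      ((Multiplicative.toAdd (exponentSum n g) : ℤ) : ZMod n) = -j := by
  rw [cyclicSubgroup, Subgroup.mem_comap, Subgroup.mem_zpowers_iff]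
  refine exists_congr fun j => ?_
  rw [Prod.ext_iff, permExponent_snd, eq_comm, eq_comm (a := (_ ^ j : _ × _).2)]
  refine and_congr Iff.rfl ?_
  rw [Prod.pow_snd, ← ofAdd_zsmul, Equiv.apply_eq_iff_eq]
  simp

theorem orderOf_finRotate (hn : 2 ≤ n) : orderOf (finRotate n) = n := by
  rw [(isCycle_finRotate_of_le hn).orderOf, support_finRotate_of_le hn]
  simp

/-- The cycle and `-1` in `ZMod n` both have order `n`, so on this subgroup either coordinate is
trivial exactly when the other is. Torsion-freeness rests on this. -/
theorem quotientPerm_eq_one_iff (hn : 2 ≤ n) {g : BraidQuotient n} (hg : g ∈ cyclicSubgroup n) :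
    quotientPerm n g = 1 ↔ ((Multiplicative.toAdd (exponentSum n g) : ℤ) : ZMod n) = 0 := by
  obtain ⟨j, h1, h2⟩ := mem_cyclicSubgroup.mp hg
  rw [h1, h2, neg_eq_zero, ZMod.intCast_zmod_eq_zero_iff_dvd, ← orderOf_dvd_iff_zpow_eq_one,
    orderOf_finRotate hn]

theorem ascProd_mem_cyclicSubgroup (hn : 1 ≤ n) : ascProd n (n - 1) ∈ cyclicSubgroup n := by
  rw [mem_cyclicSubgroup]
  refine ⟨1, by rw [quotientPerm_ascProd_last, zpow_one], ?_⟩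
  rw [exponentSum_ascProd le_rfl]
  simp [Nat.cast_sub hn]

/-- The cyclic subgroup as a monomial group. -/
noncomputable def cyclicLatticeData (hn : 3 ≤ n) :
    LatticeData (StrandPair n) (Multiplicative (ZMod n)) (cyclicSubgroup n) where
  shift g := linkingNumber g.1
  perm := (MulAction.toPermHom (Equiv.Perm (Fin n)) (StrandPair n)).comp
    ((quotientPerm n).comp (cyclicSubgroup n).subtype)
  -- The exponent sum modulo `n` serves as the projection, since it takes values in `ZMod n`
  -- directly and has the same kernel here as the permutation.
  hol := ((MonoidHom.snd _ _).comp (permExponent n)).comp (cyclicSubgroup n).subtype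
  shift_mul g h s := by
    rw [← map_inv]
    simp [linkingNumber_mul]
  eq_one g h1 h2 := Subtype.ext <| eq_one_of_linkingNumber (by omega)
    (eq_one_of_smul_strandPair hn fun s => DFunLike.congr_fun h1 s) (congrFun h2)
  hol_surjective x := by
    obtain ⟨j, hj⟩ := ZMod.intCast_surjective (Multiplicative.toAdd x)
    refine ⟨⟨ascProd n (n - 1), ascProd_mem_cyclicSubgroup (by omega)⟩ ^ (-j), ?_⟩
    have : ((n - 1 : ℕ) : ZMod n) = -1 := by simp [Nat.cast_sub (show 1 ≤ n by omega)]
    rw [map_zpow]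
    apply Multiplicative.toAdd.injective
    simp only [MonoidHom.comp_apply, Subgroup.subtype_apply, MonoidHom.coe_snd, permExponent_snd,
      exponentSum_ascProd le_rfl, toAdd_zpow, toAdd_ofAdd, Int.cast_natCast, this]
    simp [hj]
  hol_eq_one_iff g := by
    have h1 : (MulAction.toPermHom (Equiv.Perm (Fin n)) (StrandPair n)).comp
        ((quotientPerm n).comp (cyclicSubgroup n).subtype) g = 1 ↔ quotientPerm n g.1 = 1 :=
      ⟨fun h => eq_one_of_smul_strandPair hn fun s => DFunLike.congr_fun h s, fun h => by
        rw [MonoidHom.comp_apply, MonoidHom.comp_apply, Subgroup.subtype_apply, h, map_one]⟩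
    rw [h1, quotientPerm_eq_one_iff (by omega) g.2]
    exact Iff.rfl
  -- The factor `2` is the linking number of a twist; the factor `n` makes the exponent sum vanish
  -- modulo `n`.
  modulus := 2 * n
  modulus_pos := by omega
  exists_translation w := by
    have hn2 : 2 ≤ n := by omega
    set g := twistHom hn2 fun s => Multiplicative.ofAdd ((n : ℤ) * w s) with hg
    have h1 : quotientPerm n g = 1 := quotientPerm_twistHom hn2 _
    have h2 : ∀ s, linkingNumber g s = 2 * (n * w s) := linkingNumber_twistHom hn2 _
    have h3 : g ∈ cyclicSubgroup n := by
      rw [mem_cyclicSubgroup]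
      refine ⟨0, by rw [h1, zpow_zero], ?_⟩
      simp [exponentSum, h2]
    refine ⟨⟨g, h3⟩, ?_, ?_⟩
    · rw [MonoidHom.comp_apply, MonoidHom.comp_apply, Subgroup.subtype_apply, h1, map_one]
    · funext s
      rw [h2]
      push_cast
      ring
  torsionFree g hg := by
    have hg' : IsOfFinOrder g.1 := (cyclicSubgroup n).subtype.isOfFinOrder hg
    -- The exponent sum takes values in a torsion-free group, so it vanishes on `g`. Then `g` is
    -- pure, and linking numbers are additive on its powers.
    have h0 : exponentSum n g.1 = 1 := by
      obtain ⟨k, hk, h⟩ := isOfFinOrder_iff_pow_eq_one.mp ((exponentSum n).isOfFinOrder hg')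
      apply Multiplicative.toAdd.injective
      have := congrArg Multiplicative.toAdd h
      simpa [hk.ne'] using this
    have h1 : quotientPerm n g.1 = 1 := by
      rw [quotientPerm_eq_one_iff (by omega) g.2, h0]
      simp
    obtain ⟨k, hk, h⟩ := isOfFinOrder_iff_pow_eq_one.mp hg'
    refine Subtype.ext (eq_one_of_linkingNumber (by omega) h1 fun s => ?_)
    have h2 : ∀ k : ℕ, linkingNumber (g.1 ^ k) s = k * linkingNumber g.1 s := by
      intro k
      induction k with
      | zero => simp [linkingNumber]
      | succ k ih =>
        rw [pow_succ', linkingNumber_mul, h1, inv_one, one_smul, ih]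
        push_cast
        ring
    have h3 := h2 k
    rw [h] at h3
    simpa [linkingNumber, hk.ne', eq_comm] using h3

end Cyclic

/-! ### Placing braids side by side -/

section Juxtaposition

/-- The homomorphism that adds trivial strands: the strands of the first braid are put at the
positions `o, …, o + n - 1`. -/
def braidShift (n m o : ℕ) (h : o + n ≤ m) : BraidGroup n →* BraidGroup m :=
  braidLift (t := fun i => braidSeq m (o + i))
    { comm := fun i j hij hj => (braidRelations_braidSeq m).comm _ _ (by omega) (by omega)
      braid := fun i hi => (braidRelations_braidSeq m).braid (o + i) (by omega) }

theorem braidShift_braidSeq {n m o : ℕ} (h : o + n ≤ m) {i : ℕ} (hi : i + 1 < n) :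
    braidShift n m o h (braidSeq n i) = braidSeq m (o + i) :=
  braidLift_braidSeq _ (by omega)

/-- The inclusion of the positions `o, …, o + n - 1`. -/
def blockEmb (n m o : ℕ) (h : o + n ≤ m) : Fin n ↪ Fin m where
  toFun a := ⟨o + a, by omega⟩
  inj' a b hab := by
    simp only [Fin.mk.injEq] at hab
    exact Fin.ext (by omega)

theorem blockEmb_val {n m o : ℕ} (h : o + n ≤ m) (a : Fin n) :
    (blockEmb n m o h a : ℕ) = o + a := rfl

theorem adjSwap_blockEmb {n m o : ℕ} (h : o + n ≤ m) {i : ℕ} (hi : i + 1 < n) (a : Fin n) :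
    adjSwap m (o + i) (blockEmb n m o h a) = blockEmb n m o h (adjSwap n i a) := by
  rw [adjSwap_apply (show o + i + 1 < m by omega), adjSwap_apply hi]
  rw [blockEmb_val, Fin.ext_iff, blockEmb_val]
  by_cases h1 : (a : ℕ) = i
  · rw [if_pos h1, if_pos (by omega)]
    rfl
  by_cases h2 : (a : ℕ) = i + 1
  · rw [if_neg h1, if_pos h2, if_neg (by omega), if_pos (by omega)]
  · rw [if_neg h1, if_neg h2, if_neg (by omega), if_neg (by omega), blockEmb_val]

theorem braidPerm_braidShift {n m o : ℕ} (h : o + n ≤ m) (g : BraidGroup n) :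
    braidPerm m (braidShift n m o h g) = (braidPerm n g).viaEmbedding (blockEmb n m o h) := by
  have : (braidPerm m).comp (braidShift n m o h) =
      (Equiv.Perm.viaEmbeddingHom (blockEmb n m o h)).comp (braidPerm n) := by
    refine monoidHom_ext_braidSeq fun i hi => ?_
    rw [MonoidHom.comp_apply, MonoidHom.comp_apply, braidShift_braidSeq h hi, braidPerm_braidSeq,
      braidPerm_braidSeq, Equiv.Perm.viaEmbeddingHom_apply]
    refine Equiv.ext fun x => ?_
    by_cases hx : x ∈ Set.range (blockEmb n m o h)
    · obtain ⟨a, rfl⟩ := hx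
      rw [Equiv.Perm.viaEmbedding_apply, adjSwap_blockEmb h hi]
    · rw [Equiv.Perm.viaEmbedding_apply_of_notMem _ _ _ hx,
        adjSwap_apply (show o + i + 1 < m by omega)]
      have h1 : ∀ a, (ha : a < n) → (x : ℕ) ≠ o + a := fun a ha hxa =>
        hx ⟨⟨a, ha⟩, Fin.ext hxa.symm⟩
      rw [if_neg (h1 i (by omega)), if_neg (show (x : ℕ) ≠ o + i + 1 from h1 (i + 1) hi)]
  exact DFunLike.congr_fun this g

theorem map_commutator_braidShift_le {n m o : ℕ} (h : o + n ≤ m) :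
    ⁅pureBraidGroup n, pureBraidGroup n⁆ ≤
      ⁅pureBraidGroup m, pureBraidGroup m⁆.comap (braidShift n m o h) := by
  rw [← Subgroup.map_le_iff_le_comap, Subgroup.map_commutator]
  have : (pureBraidGroup n).map (braidShift n m o h) ≤ pureBraidGroup m := by
    rintro _ ⟨g, hg, rfl⟩
    rw [pureBraidGroup, MonoidHom.mem_ker, braidPerm_braidShift,
      show braidPerm n g = 1 from hg]
    exact map_one (Equiv.Perm.viaEmbeddingHom (blockEmb n m o h))
  exact Subgroup.commutator_mono this this

/-- The homomorphism induced by `braidShift` on the quotients. -/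
def quotientShift (n m o : ℕ) (h : o + n ≤ m) : BraidQuotient n →* BraidQuotient m :=
  QuotientGroup.map _ _ (braidShift n m o h) (map_commutator_braidShift_le h)

theorem quotientShift_quotientSeq {n m o : ℕ} (h : o + n ≤ m) {i : ℕ} (hi : i + 1 < n) :
    quotientShift n m o h (quotientSeq n i) = quotientSeq m (o + i) :=
  congrArg QuotientGroup.mk (braidShift_braidSeq h hi)

theorem map_quotientShift_le {n m o : ℕ} (h : o + n ≤ m) {H : Subgroup (BraidQuotient m)}
    (hH : ∀ i, i + 1 < n → quotientSeq m (o + i) ∈ H) : (quotientShift n m o h).range ≤ H := by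
  rw [MonoidHom.range_eq_map, ← initialClosure_quotientSeq, map_initialClosure, initialClosure,
    Subgroup.closure_le]
  rintro _ ⟨i, hi, rfl⟩
  simp only [Set.mem_Iio] at hi
  change quotientShift n m o h (quotientSeq n i) ∈ H
  rw [quotientShift_quotientSeq h (by omega)]
  exact hH i (by omega)

/-- Generators of the first block have index at most `o + n - 2` and those of the second at least `o
+ n`, so they are distant. Applying centralizers on both sides reduces the claim to generators. -/
theorem commute_quotientShift {n n' m o o' : ℕ} (h : o + n ≤ m) (h' : o' + n' ≤ m)
    (hoo : o + n ≤ o') (x : BraidQuotient n) (y : BraidQuotient n') :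
    Commute (quotientShift n m o h x) (quotientShift n' m o' h' y) := by
  have hy : (quotientShift n' m o' h').range ≤
      Subgroup.centralizer ((quotientShift n m o h).range : Set (BraidQuotient m)) := by
    refine map_quotientShift_le h' fun j hj => ?_
    rw [← Subgroup.zpowers_le, Subgroup.le_centralizer_iff]
    refine map_quotientShift_le h fun i hi => ?_
    rw [Subgroup.mem_centralizer_iff]
    rintro _ ⟨k, rfl⟩
    have : Commute (quotientSeq m (o + i)) (quotientSeq m (o' + j)) :=
      (braidRelations_quotientSeq m).comm _ _ (by omega) (by omega)
    exact (this.zpow_right k).eq.symm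
  exact Subgroup.mem_centralizer_iff.mp (hy ⟨y, rfl⟩) _ ⟨x, rfl⟩

/-- The relation between an element `w` of a linking group and an element `w'` of a larger one that
restricts to `w` on the block of positions `o, …, o + n - 1`. -/
def blockRelation (n m o : ℕ) (h : o + n ≤ m) : Subgroup (LinkingGroup n × LinkingGroup m) where
  carrier := {p | (∀ a, p.2.right (blockEmb n m o h a) = blockEmb n m o h (p.1.right a)) ∧
    ∀ a b, ∀ hab : a ≠ b, p.2.left (strandPair (blockEmb n m o h a) (blockEmb n m o h b)
      ((blockEmb n m o h).injective.ne hab)) = p.1.left (strandPair a b hab)}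
  one_mem' := ⟨fun _ => rfl, fun _ _ _ => rfl⟩
  mul_mem' := by
    rintro ⟨x, x'⟩ ⟨y, y'⟩ ⟨h1, h2⟩ ⟨h3, h4⟩
    have h5 : ∀ a, x'.right⁻¹ (blockEmb n m o h a) = blockEmb n m o h (x.right⁻¹ a) := by
      intro a
      rw [Equiv.Perm.inv_eq_iff_eq, h1, ← Equiv.Perm.mul_apply, mul_inv_cancel,
        Equiv.Perm.one_apply]
    refine ⟨fun a => ?_, fun a b hab => ?_⟩
    · simp only [Prod.mk_mul_mk, SemidirectProduct.mul_right, Equiv.Perm.mul_apply]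
      rw [h3, h1]
    · simp only [Prod.mk_mul_mk, SemidirectProduct.mul_left, Pi.mul_apply]
      rw [h2 a b hab]
      congr 1
      change y'.left (x'.right⁻¹ • strandPair _ _ _) = y.left (x.right⁻¹ • strandPair _ _ _)
      rw [smul_strandPair, smul_strandPair, ← h4]
      simp only [h5]
  inv_mem' := by
    rintro ⟨x, x'⟩ ⟨h1, h2⟩
    refine ⟨fun a => ?_, fun a b hab => ?_⟩
    · simp only [Prod.inv_mk, SemidirectProduct.inv_right]
      rw [Equiv.Perm.inv_eq_iff_eq, h1, ← Equiv.Perm.mul_apply, mul_inv_cancel,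
        Equiv.Perm.one_apply]
    · simp only [Prod.inv_mk, SemidirectProduct.inv_left]
      change (x'.left ((x'.right⁻¹)⁻¹ • strandPair _ _ _))⁻¹ =
        (x.left ((x.right⁻¹)⁻¹ • strandPair _ _ _))⁻¹
      rw [inv_inv, inv_inv, smul_strandPair, smul_strandPair, ← h2]
      simp only [h1]

theorem eq_one_of_mem_blockRelation {n m o : ℕ} {h : o + n ≤ m} {w : LinkingGroup n}
    (hw : (w, 1) ∈ blockRelation n m o h) : w = 1 := by
  obtain ⟨h1, h2⟩ := hw
  refine SemidirectProduct.ext ?_ ?_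
  · funext s
    obtain ⟨a, b, hab, rfl⟩ := exists_strandPair s
    exact (h2 a b hab).symm
  · exact Equiv.ext fun a => (blockEmb n m o h).injective (h1 a).symm

theorem linkingSeq_mem_blockRelation {n m o : ℕ} (h : o + n ≤ m) {i : ℕ} (hi : i + 1 < n) :
    (linkingSeq n i, linkingSeq m (o + i)) ∈ blockRelation n m o h := by
  rw [linkingSeq_of_lt hi, linkingSeq_of_lt (show o + i + 1 < m by omega)]
  refine ⟨fun a => adjSwap_blockEmb h hi a, fun a b hab => ?_⟩
  simp only [Pi.mulSingle_apply, strandPair_eq_iff, Fin.ext_iff, blockEmb_val]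
  refine if_congr ?_ rfl rfl
  omega

/-- A generator acting wholly outside the block fixes its positions, and the pair it records is not
contained in the block. -/
theorem linkingSeq_mem_blockRelation_of_disjoint {n m o : ℕ} (h : o + n ≤ m) {k : ℕ}
    (hk : k + 1 < m) (hd : k + 1 < o ∨ o + n ≤ k) :
    (1, linkingSeq m k) ∈ blockRelation n m o h := by
  rw [linkingSeq_of_lt hk]
  refine ⟨fun a => ?_, fun a b hab => ?_⟩
  · change adjSwap m k _ = _
    rw [adjSwap_apply hk, if_neg, if_neg]
    · rfl
    · change ¬ o + (a : ℕ) = k + 1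
      omega
    · change ¬ o + (a : ℕ) = k
      omega
  · refine Pi.mulSingle_eq_of_ne ?_ _
    rw [Ne, strandPair_eq_iff]
    simp only [Fin.ext_iff, blockEmb_val]
    omega

/-- Restriction to a block is not a homomorphism on the whole linking group, but its graph
`blockRelation` is a subgroup, so generators suffice. -/
theorem quotientShift_mem_blockRelation {n m o : ℕ} (h : o + n ≤ m) (g : BraidQuotient n) :
    (quotientLinking n g, quotientLinking m (quotientShift n m o h g)) ∈
      blockRelation n m o h := by
  have : (⊤ : Subgroup (BraidQuotient n)) ≤ (blockRelation n m o h).comap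
      ((quotientLinking n).prod ((quotientLinking m).comp (quotientShift n m o h))) := by
    rw [← initialClosure_quotientSeq, initialClosure, Subgroup.closure_le]
    rintro _ ⟨i, hi, rfl⟩
    simp only [Set.mem_Iio] at hi
    rw [SetLike.mem_coe, Subgroup.mem_comap, MonoidHom.prod_apply, MonoidHom.comp_apply,
      quotientShift_quotientSeq h (by omega), quotientLinking_quotientSeq (by omega),
      quotientLinking_quotientSeq (by omega)]
    exact linkingSeq_mem_blockRelation h (by omega)
  exact this (Subgroup.mem_top g)

theorem quotientShift_mem_blockRelation_of_disjoint {n n' m o o' : ℕ} (h : o + n ≤ m)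
    (h' : o' + n' ≤ m) (hd : o' + n' ≤ o ∨ o + n ≤ o') (g : BraidQuotient n') :
    (1, quotientLinking m (quotientShift n' m o' h' g)) ∈ blockRelation n m o h := by
  have : (quotientShift n' m o' h').range ≤ (blockRelation n m o h).comap
      ((1 : BraidQuotient m →* LinkingGroup n).prod (quotientLinking m)) := by
    refine map_quotientShift_le h' fun i hi => ?_
    rw [Subgroup.mem_comap, MonoidHom.prod_apply, quotientLinking_quotientSeq (by omega)]
    exact linkingSeq_mem_blockRelation_of_disjoint h (by omega) (by omega)
  exact this ⟨g, rfl⟩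

/-- The first position of the `i`-th block. -/
def blockStart {t : ℕ} (n : Fin t → ℕ) (i : Fin t) : ℕ := ∑ l ∈ Finset.Iio i, n l

variable {t : ℕ} {n : Fin t → ℕ}

theorem blockStart_add_le_sum (s : Finset (Fin t)) {i : Fin t} (hs : Finset.Iic i ⊆ s) :
    blockStart n i + n i ≤ ∑ l ∈ s, n l := by
  rw [blockStart, add_comm, ← Finset.sum_insert (s := Finset.Iio i) (by simp)]
  refine Finset.sum_le_sum_of_subset fun x hx => hs ?_
  simp only [Finset.mem_insert, Finset.mem_Iio, Finset.mem_Iic] at hx ⊢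
  exact hx.elim (fun h => h.le) (fun h => h.le)

theorem blockStart_add_le {i j : Fin t} (h : i < j) :
    blockStart n i + n i ≤ blockStart n j :=
  blockStart_add_le_sum _ fun x hx => by
    simp only [Finset.mem_Iio, Finset.mem_Iic] at hx ⊢
    exact hx.trans_lt h

theorem blockStart_add_le_of_sum_le {m : ℕ} (hm : ∑ i, n i ≤ m) (i : Fin t) :
    blockStart n i + n i ≤ m :=
  (blockStart_add_le_sum _ (Finset.subset_univ _)).trans hm

theorem pairwise_commute_quotientShift {m : ℕ} (hm : ∑ i, n i ≤ m) :
    Pairwise fun i j => ∀ (x : BraidQuotient (n i)) (y : BraidQuotient (n j)),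
      Commute (quotientShift (n i) m _ (blockStart_add_le_of_sum_le hm i) x)
        (quotientShift (n j) m _ (blockStart_add_le_of_sum_le hm j) y) := by
  intro i j hij x y
  rcases lt_or_gt_of_ne hij with h | h
  · exact commute_quotientShift _ _ (blockStart_add_le h) x y
  · exact (commute_quotientShift _ _ (blockStart_add_le h) y x).symm

/-- The homomorphism that places braids side by side. -/
noncomputable def juxtapose {m : ℕ} (hm : ∑ i, n i ≤ m) :
    (∀ i, BraidQuotient (n i)) →* BraidQuotient m :=
  MonoidHom.noncommPiCoprod
    (fun i => quotientShift (n i) m (blockStart n i) (blockStart_add_le_of_sum_le hm i))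
    (pairwise_commute_quotientShift hm)

theorem juxtapose_mulSingle {m : ℕ} (hm : ∑ i, n i ≤ m) (i : Fin t) (g : BraidQuotient (n i)) :
    juxtapose hm (Pi.mulSingle i g) =
      quotientShift (n i) m _ (blockStart_add_le_of_sum_le hm i) g := by
  rw [juxtapose, MonoidHom.noncommPiCoprod_mulSingle]

theorem map_mem_of_mulSingle {ι : Type*} [Fintype ι] [DecidableEq ι] {G : ι → Type*}
    [∀ i, Group (G i)] {K : Type*} [Group K] (f : (∀ i, G i) →* K) {H : Subgroup K}
    (hH : ∀ i x, f (Pi.mulSingle i x) ∈ H) (g : ∀ i, G i) : f g ∈ H := by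
  have hcomm : Pairwise fun i j => ∀ (x : G i) (y : G j),
      Commute (f.comp (MonoidHom.mulSingle G i) x) (f.comp (MonoidHom.mulSingle G j) y) :=
    fun i j hij x y => (Pi.mulSingle_commute hij x y).map f
  have hf : f = MonoidHom.noncommPiCoprod (fun i => f.comp (MonoidHom.mulSingle G i)) hcomm := by
    refine MonoidHom.pi_ext fun i x => ?_
    rw [MonoidHom.noncommPiCoprod_mulSingle]
    rfl
  have hr : f.range ≤ H := by
    rw [hf, MonoidHom.noncommPiCoprod_range, iSup_le_iff]
    rintro i _ ⟨x, rfl⟩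
    exact hH i x
  exact hr ⟨g, rfl⟩

theorem juxtapose_mem_blockRelation {m : ℕ} (hm : ∑ i, n i ≤ m) (g : ∀ i, BraidQuotient (n i))
    (i : Fin t) : (quotientLinking (n i) (g i), quotientLinking m (juxtapose hm g)) ∈
      blockRelation (n i) m (blockStart n i) (blockStart_add_le_of_sum_le hm i) := by
  let f : (∀ i, BraidQuotient (n i)) →* LinkingGroup (n i) × LinkingGroup m :=
    ((quotientLinking (n i)).comp (Pi.evalMonoidHom _ i)).prod
      ((quotientLinking m).comp (juxtapose hm))
  refine map_mem_of_mulSingle f (fun l x => ?_) g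
  simp only [f, MonoidHom.comp_apply, MonoidHom.prod_apply, 
    juxtapose_mulSingle, Pi.evalMonoidHom_apply]
  by_cases hl : l = i
  · subst hl
    rw [Pi.mulSingle_eq_same]
    exact quotientShift_mem_blockRelation _ x
  · rw [Pi.mulSingle_eq_of_ne (Ne.symm hl), map_one]
    apply quotientShift_mem_blockRelation_of_disjoint
    exact (lt_or_gt_of_ne hl).imp blockStart_add_le blockStart_add_le

/-- The linking data of each factor reappears on its block, and these data determine the factor. -/
theorem juxtapose_injective {m : ℕ} (hm : ∑ i, n i ≤ m) (hn : ∀ i, 2 ≤ n i) :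
    Function.Injective (juxtapose hm) := by
  rw [injective_iff_map_eq_one]
  intro g hg
  funext i
  apply quotientLinking_injective (hn i)
  have := juxtapose_mem_blockRelation hm g i
  rw [hg, map_one] at this
  rw [eq_one_of_mem_blockRelation this, Pi.one_apply, map_one]

end Juxtaposition

/-! ### Dimension bound and assembly -/

theorem sum_choose_two_le {ι : Type*} (s : Finset ι) (n : ι → ℕ) :
    ∑ i ∈ s, (n i).choose 2 ≤ (∑ i ∈ s, n i).choose 2 := by
  classical
  induction s using Finset.induction_on with
  | empty => simp
  | insert a s ha ih =>
    rw [Finset.sum_insert ha, Finset.sum_insert ha, Nat.add_choose_eq]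
    -- In Vandermonde's identity only the two terms choosing both elements from the same part are
    -- kept.
    have h := Finset.sum_le_sum_of_subset
      (f := fun ij : ℕ × ℕ => (n a).choose ij.1 * (∑ i ∈ s, n i).choose ij.2)
      (show ({(2, 0), (0, 2)} : Finset (ℕ × ℕ)) ⊆ Finset.HasAntidiagonal.antidiagonal 2 by decide)
    rw [Finset.sum_pair (by decide)] at h
    simp only [Nat.choose_zero_right, mul_one, one_mul] at h
    omega

/-- The product of a family of subgroups, as a subgroup of the product of the groups. -/
def subgroupPiEquiv {ι : Type*} {G : ι → Type*} [∀ i, Group (G i)] (H : ∀ i, Subgroup (G i)) :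
    Subgroup.pi Set.univ H ≃* ∀ i, H i where
  toFun g i := ⟨g.1 i, g.2 i trivial⟩
  invFun g := ⟨fun i => g i, fun i _ => (g i).2⟩
  left_inv _ := rfl
  right_inv _ := rfl
  map_mul' _ _ := rfl

theorem proposition3p2 (t : ℕ) (n : Fin t → ℕ) (hpp : ∀ i, IsPrimePow (n i))
    (hn : ∀ i, 3 ≤ n i) (m : ℕ) (hm : ∑ i, n i ≤ m) :
    ∑ i, (n i).choose 2 ≤ m.choose 2 ∧
    ∃ Γ : Subgroup (BraidQuotient m),
      -- `Γ` is a Bieberbach subgroup with the stated dimension and holonomy group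
      IsBieberbach (∑ i, (n i).choose 2) (Multiplicative (∀ i, ZMod (n i))) Γ ∧
      -- `Γ` is the image of a product of Bieberbach subgroups of the `B_{n_i} / [P_{n_i}, P_{n_i}]`
      -- under the embedding that places the braids side by side
      ∃ (Δ : ∀ i, Subgroup (BraidQuotient (n i)))
        (ι : (∀ i, BraidQuotient (n i)) →* BraidQuotient m),
        (∀ i, IsBieberbach ((n i).choose 2) (Multiplicative (ZMod (n i))) (Δ i)) ∧
        Function.Injective ι ∧
        (∀ (i : Fin t) (j : Fin (n i - 1)) (k : Fin (m - 1)),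
          (k : ℕ) = (∑ l ∈ Finset.Iio i, n l) + (j : ℕ) →
            ι (Pi.mulSingle i (braidQuotientGen (n i) j)) = braidQuotientGen m k) ∧
        Γ = (Subgroup.pi Set.univ Δ).map ι := by
  have hcard : ∀ k, Fintype.card (StrandPair k) = k.choose 2 := fun k => by
    rw [Sym2.card_subtype_not_diag, Fintype.card_fin]
  have hne : ∀ i, NeZero (n i) := fun i => ⟨by have := hn i; omega⟩
  have hinj : Function.Injective (juxtapose hm) :=
    juxtapose_injective hm fun i => (Nat.le_succ 2).trans (hn i)
  have hgen : ∀ (k : ℕ) (j : Fin (k - 1)), braidQuotientGen k j = quotientSeq k j := by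
    intro k j
    rw [quotientSeq, braidSeq, dif_pos j.2]
    rfl
  have hfin : ∀ i, Finite (ZMod (n i)) := fun i => inferInstance
  have hfin' : Finite (Multiplicative (∀ i, ZMod (n i))) :=
    Finite.of_equiv _ Multiplicative.ofAdd
  refine ⟨(sum_choose_two_le _ n).trans (Nat.choose_le_choose 2 hm),
    (Subgroup.pi Set.univ fun i => cyclicSubgroup (n i)).map (juxtapose hm), ?_,
    fun i => cyclicSubgroup (n i), juxtapose hm, fun i => ?_, hinj, ?_, rfl⟩
  -- Injectivity identifies the image with the abstract product, so the product data transfers to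
  -- it.
  · refine ((LatticeData.pi fun i => cyclicLatticeData (hn i)).congr
      (((Subgroup.pi Set.univ fun i => cyclicSubgroup (n i)).equivMapOfInjective _ hinj).symm.trans
        (subgroupPiEquiv _))).isBieberbach ?_
    simp [Fintype.card_sigma, hcard]
  · exact (cyclicLatticeData (hn i)).isBieberbach (hcard _)
  · intro i j k hk
    rw [juxtapose_mulSingle, hgen, hgen, quotientShift_quotientSeq _ (by omega), hk]
    rfl
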